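/- Let $(\mathcal C,\mathbb E,\mathfrak s)$ be a small extriangulated category with enough $\mathbb E$-projectives and enough $\mathbb E$-injectives, and let $\mathcal X\subseteq\mathcal C$ be a $2$-cluster tilting subcategory: every object $C$ admits a conflation $K\to X\xrightarrow{g} C$ with $g$ an $\mathcal X$-precover and a conflation $C\xrightarrow{f} X'\to L$ with $f$ an $\mathcal X$-preenvelope ($X,X'\in\mathcal X$), and $$\mathcal X=\{N\in\mathcal C:\mathbb E(\mathcal X,N)=0\}=\{N\in\mathcal C:\mathbb E(N,\mathcal X)=0\}.$$ Notation. $[\mathcal X]$ is the ideal of morphisms that factor through an object of $\mathcal X$, and $\mathcal C/[\mathcal X]$ is the quotient category. $\mathrm{Proj}$ (resp. $\mathrm{Inj}$) denotes the class of projective (resp. injective) objects, defined by lifting along epimorphisms (resp. extension along monomorphisms), and $\mathrm{smd}$ the class of direct summands. $\Omega(\mathcal X)$ is the class of objects $A$ that admit a conflation $A\to P\to X$ with $P$ $\mathbb E$-projective and $X\in\mathcal X$; $\Sigma(\mathcal X)$ is the class of objects $B$ that admit a conflation $X\to I\to B$ with $I$ $\mathbb E$-injective and $X\in\mathcal X$.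 For a class $\mathcal P$ of objects of $\mathcal C$, $\mathcal P/[\mathcal X]$ is the class of the same objects in $\mathcal C/[\mathcal X]$. $\underline{\mathcal X}$ is the quotient of $\mathcal X$ by the ideal of the morphisms $f$ with $\mathbb E(f,-)=0$, and $\overline{\mathcal X}$ is its quotient by the ideal of the morphisms $f$ with $\mathbb E(-,f)=0$. $\mathrm{fp}\,\underline{\mathcal X}$ (resp. $\overline{\mathcal X}\,\mathrm{fp}$) is the category of finitely presented right $\underline{\mathcal X}$-modules (resp. left $\overline{\mathcal X}$-modules), that is, of the additive contravariant (resp. covariant) functors to abelian groups that are cokernels of morphisms between finite coproducts of representable functors. The functor $\mathbb F$ on $\mathcal C/[\mathcal X]$ sends $M$ to $\mathbb E(-,M)|_{\mathcal X}$, a right $\underline{\mathcal X}$-module, and the contravariant functor $\mathbb K$ on $\mathcal C/[\mathcal X]$ sends $M$ to $\mathbb E(M,-)|_{\mathcal X}$, a left $\overline{\mathcal X}$-module. Then: (a) $\mathcal C/[\mathcal X]$ is an abelian category with enough projectives and enough injectives, and $$\mathrm{Proj}(\mathcal C/[\mathcal X])=\mathrm{smd}(\Omega(\mathcal X)/[\mathcal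 X]),\qquad \mathrm{Inj}(\mathcal C/[\mathcal X])=\mathrm{smd}(\Sigma(\mathcal X)/[\mathcal X]).$$ (b) If $\mathcal C$ is Krull–Schmidt (every object is a finite coproduct of objects with local endomorphism rings), then $\mathcal C/[\mathcal X]$ is Krull–Schmidt, and, up to isomorphism in $\mathcal C/[\mathcal X]$, $\mathrm{Proj}(\mathcal C/[\mathcal X])=\Omega(\mathcal X)/[\mathcal X]$ and $\mathrm{Inj}(\mathcal C/[\mathcal X])=\Sigma(\mathcal X)/[\mathcal X]$. (c) $\mathbb F$ takes values in $\mathrm{fp}\,\underline{\mathcal X}$, the category $\mathrm{fp}\,\underline{\mathcal X}$ is abelian, and $\mathbb F:\mathcal C/[\mathcal X]\to\mathrm{fp}\,\underline{\mathcal X}$ is an (additive) equivalence of abelian categories; a sequence in $\mathcal C/[\mathcal X]$ is short exact if and only if its image under $\mathbb F$ is a short exact sequence of $\underline{\mathcal X}$-modules. Moreover, $\mathbb K$ takes values in $\overline{\mathcal X}\,\mathrm{fp}$ and $\mathbb K:\mathcal C/[\mathcal X]\to\overline{\mathcal X}\,\mathrm{fp}$ is a duality of exact categories. Here $\mathcal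 C/[\mathcal X]$ carries the class $\varepsilon_{\mathbb K}$ of the pairs $A'\to A\to A''$ for which $0\to\mathbb K(A'')\to\mathbb K(A)\to\mathbb K(A')\to0$ is exact, and $\overline{\mathcal X}\,\mathrm{fp}$ carries the class of the short exact sequences of $\overline{\mathcal X}$-modules with finitely presented terms; both are exact structures in the sense of Quillen, and the (additive) contravariant equivalence $\mathbb K$ preserves and reflects them. -/

import Mathlib

open CategoryTheory Limits Opposite ZeroObject

universe v u

noncomputable section

namespace Extri

/-! ### Ideals of preadditive categories and quotient categories -/

section Ideals

variable {C : Type u} [Category.{v} C] [Preadditive C]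

variable (C) in
/-- A two-sided ideal of a preadditive category. -/
structure AddIdeal where
  carrier (X Y : C) : AddSubgroup (X ⟶ Y)
  precomp_mem {X Y Z : C} (f : X ⟶ Y) {g : Y ⟶ Z} : g ∈ carrier Y Z → f ≫ g ∈ carrier X Z
  postcomp_mem {X Y Z : C} {f : X ⟶ Y} (g : Y ⟶ Z) : f ∈ carrier X Y → f ≫ g ∈ carrier X Z

/-- Two parallel morphisms are identified when their difference lies in the ideal. -/
def AddIdeal.rel (I : AddIdeal C) : HomRel C := fun X Y f g => f - g ∈ I.carrier X Y

instance (I : AddIdeal C) : Congruence I.rel where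
  comp_left f g g' h := by
    have := I.precomp_mem f h
    rwa [Preadditive.comp_sub] at this
  comp_right g h := by
    have := I.postcomp_mem g h
    rwa [Preadditive.sub_comp] at this
  equivalence :=
    { refl := fun f => by simp [AddIdeal.rel]
      symm := fun {f g} h => by
        have := (I.carrier _ _).neg_mem h
        rwa [neg_sub] at this
      trans := fun {f g k} h h' => by
        have := (I.carrier _ _).add_mem h h'
        rwa [sub_add_sub_cancel] at this }

/-- The quotient category `C / I`: same objects, morphisms `Hom(X, Y) / I(X, Y)`. -/
abbrev AddIdeal.Quot (I : AddIdeal C) := CategoryTheory.Quotient I.rel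

/-- The canonical functor `C ⥤ C / I`. -/
abbrev AddIdeal.proj (I : AddIdeal C) : C ⥤ I.Quot := CategoryTheory.Quotient.functor I.rel

lemma AddIdeal.rel_add (I : AddIdeal C) ⦃X Y : C⦄ (f₁ f₂ g₁ g₂ : X ⟶ Y)
    (hf : I.rel f₁ f₂) (hg : I.rel g₁ g₂) : I.rel (f₁ + g₁) (f₂ + g₂) := by
  have := (I.carrier _ _).add_mem hf hg
  rwa [sub_add_sub_comm] at this

instance (I : AddIdeal C) : Preadditive I.Quot := CategoryTheory.Quotient.preadditive I.rel I.rel_add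

instance (I : AddIdeal C) : I.proj.Additive := CategoryTheory.Quotient.functor_additive I.rel I.rel_add

/-- The restriction of an ideal to a full subcategory. -/
def AddIdeal.restrict (I : AddIdeal C) (X : ObjectProperty C) : AddIdeal X.FullSubcategory where
  carrier A B := (I.carrier A.obj B.obj).comap (X.ι.mapAddHom (X := A) (Y := B))
  precomp_mem f _ h := I.precomp_mem f.hom h
  postcomp_mem g h := I.postcomp_mem g.hom h

/-- `X` contains the zero objects and is closed under finite coproducts. -/
class ClosedUnderFiniteCoproducts [HasZeroObject C] [HasBinaryBiproducts C] (X : ObjectProperty C) : Prop where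
  zero (Z : C) : IsZero Z → X Z
  biprod (A B : C) : X A → X B → X (A ⊞ B)

/-- `[X]`: the ideal of the morphisms which factor through an object of `X`. -/
def factorIdeal [HasZeroObject C] [HasBinaryBiproducts C] (X : ObjectProperty C) [ClosedUnderFiniteCoproducts X] :
    AddIdeal C where
  carrier A B :=
    { carrier := {f | ∃ (W : C) (_ : X W) (g : A ⟶ W) (h : W ⟶ B), g ≫ h = f}
      zero_mem' := ⟨0, ClosedUnderFiniteCoproducts.zero _ (isZero_zero C), 0, 0, by simp⟩
      add_mem' := by
        rintro _ _ ⟨W, hW, g, h, rfl⟩ ⟨W', hW', g', h', rfl⟩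
        exact ⟨W ⊞ W', ClosedUnderFiniteCoproducts.biprod _ _ hW hW', biprod.lift g g',
          biprod.desc h h', by simp⟩
      neg_mem' := by
        rintro _ ⟨W, hW, g, h, rfl⟩
        exact ⟨W, hW, -g, h, by simp⟩ }
  precomp_mem := by
    rintro _ _ _ f _ ⟨W, hW, g, h, rfl⟩
    exact ⟨W, hW, f ≫ g, h, by simp⟩
  postcomp_mem := by
    rintro _ _ _ _ k ⟨W, hW, g, h, rfl⟩
    exact ⟨W, hW, g, h ≫ k, by simp⟩

end Ideals

/-! ### Modules over a preadditive category -/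

section Modules

variable (Z : Type u) [Category.{v} Z] [Preadditive Z]

/-- Left `Z`-modules: additive covariant functors to abelian groups. -/
abbrev LeftMod := Z ⥤+ AddCommGrpCat.{v}

/-- Right `Z`-modules: additive contravariant functors to abelian groups. -/
abbrev RightMod := Zᵒᵖ ⥤+ AddCommGrpCat.{v}

/-- Finitely presented left modules: cokernels of morphisms between finite coproducts of
representable functors `Z(P, -)`. -/
def leftFp : ObjectProperty (LeftMod Z) := fun M =>
  ∃ (m n : ℕ) (P : Fin m → Z) (Q : Fin n → Z)
    (f : (∐ fun i => preadditiveCoyoneda.obj (op (P i))) ⟶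
      (∐ fun j => preadditiveCoyoneda.obj (op (Q j)))),
    Nonempty (M.obj ≅ cokernel f)

/-- Finitely presented right modules: cokernels of morphisms between finite coproducts of
representable functors `Z(-, P)`. -/
def rightFp : ObjectProperty (RightMod Z) := fun M =>
  ∃ (m n : ℕ) (P : Fin m → Z) (Q : Fin n → Z)
    (f : (∐ fun i => preadditiveYoneda.obj (P i)) ⟶ (∐ fun j => preadditiveYoneda.obj (Q j))),
    Nonempty (M.obj ≅ cokernel f)

end Modules

/-- A sequence `0 → M' → M → M'' → 0` of modules is exact. Exactness of additive functors is
exactness in the category of all functors to abelian groups, that is, objectwise exactness. -/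
def modShortExact {Z : Type u} [Category.{v} Z] [Preadditive Z] :
    ObjectProperty (ShortComplex (Z ⥤+ AddCommGrpCat.{v})) :=
  fun S => (S.map (AdditiveFunctor.forget Z AddCommGrpCat.{v})).ShortExact

instance lift_additive {A : Type*} {B : Type*} [Category* A] [Category* B] [Preadditive A]
    [Preadditive B] (P : ObjectProperty B) (F : A ⥤ B) [F.Additive] (h : ∀ M, P (F.obj M)) :
    (P.lift F h).Additive where
  map_add := by
    intros
    apply ObjectProperty.hom_ext
    exact F.map_add

/-! ### Exact categories in the sense of Quillen -/

section Exact

variable {D : Type u} [Category.{v} D] [Preadditive D]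

/-- `i` is the first morphism of a pair in the class `ε`. -/
def AdmissibleMono (ε : ObjectProperty (ShortComplex D)) {A B : D} (i : A ⟶ B) : Prop :=
  ∃ (Q : D) (p : B ⟶ Q) (w : i ≫ p = 0), ε (ShortComplex.mk i p w)

/-- `p` is the second morphism of a pair in the class `ε`. -/
def AdmissibleEpi (ε : ObjectProperty (ShortComplex D)) {B Q : D} (p : B ⟶ Q) : Prop :=
  ∃ (A : D) (i : A ⟶ B) (w : i ≫ p = 0), ε (ShortComplex.mk i p w)

/-- `(D, ε)` is an exact category: `D` is additive and `ε` is a class of kernel-cokernel pairs,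
closed under isomorphisms, satisfying the axioms of an exact structure. -/
structure IsExactCategory (ε : ObjectProperty (ShortComplex D)) : Prop where
  additive : HasFiniteBiproducts D
  iso_closed : ε.IsClosedUnderIsomorphisms
  isKernel (S : ShortComplex D) : ε S → Nonempty (IsLimit (KernelFork.ofι S.f S.zero))
  isCokernel (S : ShortComplex D) : ε S → Nonempty (IsColimit (CokernelCofork.ofπ S.g S.zero))
  id_mono (A : D) : AdmissibleMono ε (𝟙 A)
  id_epi (A : D) : AdmissibleEpi ε (𝟙 A)
  comp_mono {A B B' : D} (i : A ⟶ B) (j : B ⟶ B') :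
    AdmissibleMono ε i → AdmissibleMono ε j → AdmissibleMono ε (i ≫ j)
  comp_epi {A B B' : D} (p : A ⟶ B) (q : B ⟶ B') :
    AdmissibleEpi ε p → AdmissibleEpi ε q → AdmissibleEpi ε (p ≫ q)
  pushout {A B A' : D} (i : A ⟶ B) (f : A ⟶ A') : AdmissibleMono ε i →
    ∃ (B' : D) (f' : B ⟶ B') (i' : A' ⟶ B'), IsPushout i f f' i' ∧ AdmissibleMono ε i'
  pullback {B Q Q' : D} (p : B ⟶ Q) (f : Q' ⟶ Q) : AdmissibleEpi ε p →
    ∃ (B' : D) (f' : B' ⟶ B) (p' : B' ⟶ Q'), IsPullback f' p' p f ∧ AdmissibleEpi ε p'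

variable (D) in
/-- The preadditive category `D` is abelian (for its given addition of morphisms). -/
def IsAbelian : Prop := ∃ A : Abelian D, A.toPreadditive = ‹Preadditive D›

variable (D) in
/-- Every object of `D` is a finite coproduct of objects with local endomorphism rings. -/
def IsKrullSchmidt : Prop :=
  ∀ X : D, ∃ (n : ℕ) (Y : Fin n → D) (b : Bicone Y),
    Nonempty b.IsBilimit ∧ b.pt = X ∧ ∀ i, IsLocalRing (End (Y i))

/-- `smd(P)`: the direct summands of the objects of `P`. -/
def smd (P : ObjectProperty D) : ObjectProperty D := fun A =>
  ∃ (B : D) (b : BinaryBicone A B), Nonempty b.IsBilimit ∧ P b.pt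

end Exact

/-! ### Extriangulated categories -/

/-- A sequence `A ⟶ mid ⟶ Z`. -/
structure ExtSeq {C : Type u} [Category.{v} C] (A Z : C) where
  mid : C
  i : A ⟶ mid
  p : mid ⟶ Z

/-- Equivalence of sequences with the same end terms. -/
instance extSeqSetoid {C : Type u} [Category.{v} C] (A Z : C) : Setoid (ExtSeq A Z) where
  r S T := ∃ b : S.mid ≅ T.mid, S.i ≫ b.hom = T.i ∧ b.hom ≫ T.p = S.p
  iseqv :=
    { refl := fun S => ⟨Iso.refl _, by simp, by simp⟩
      symm := by
        rintro S T ⟨b, h, h'⟩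
        exact ⟨b.symm, by simp [← h], by simp [← h']⟩
      trans := by
        rintro S T U ⟨b, h, h'⟩ ⟨c, k, k'⟩
        exact ⟨b ≪≫ c, by simp [← k, ← h], by simp [← h', ← k']⟩ }

/-- An additive bifunctor `E : Cᵒᵖ × C → Ab`, together with a correspondence `s` which associates
to each `δ ∈ E(Z, A)` an equivalence class of sequences `A ⟶ B ⟶ Z`. -/
class ExtensionData (C : Type u) [Category.{v} C] [Preadditive C] where
  E : Cᵒᵖ ⥤ C ⥤ AddCommGrpCat.{v}
  additive_left : E.Additive
  additive_right (Z : Cᵒᵖ) : (E.obj Z).Additive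
  s {Z A : C} : (E.obj (op Z)).obj A → _root_.Quotient (extSeqSetoid A Z)

section

variable {C : Type u} [Category.{v} C] [Preadditive C] [ExtensionData C]

/-- The group `E(Z, A)` of extensions. -/
abbrev Ex (Z A : C) : Type v := (ExtensionData.E.obj (op Z)).obj A

/-- `a · δ`. -/
def push {Z A A' : C} (a : A ⟶ A') (δ : Ex Z A) : Ex Z A' :=
  (ExtensionData.E.obj (op Z)).map a δ

/-- `δ · c`. -/
def pull {Z Z' A : C} (δ : Ex Z A) (c : Z' ⟶ Z) : Ex Z' A :=
  (ExtensionData.E.map c.op).app A δ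

/-- The sequence `A ⟶ B ⟶ Z` realizes `δ`. -/
def Realizes {A B Z : C} (x : A ⟶ B) (y : B ⟶ Z) (δ : Ex Z A) : Prop :=
  ExtensionData.s δ = Quotient.mk _ (ExtSeq.mk B x y)

/-- `δ ⊕ δ'`. -/
def extSum [HasZeroObject C] [HasBinaryBiproducts C] {A A' Z Z' : C} (δ : Ex Z A) (δ' : Ex Z' A') :
    Ex (Z ⊞ Z') (A ⊞ A') :=
  push biprod.inl (pull δ biprod.fst) + push biprod.inr (pull δ' biprod.snd)

end

/-- Extriangulated categories. -/
class ExtriangulatedCategory (C : Type u) [Category.{v} C] [Preadditive C]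
    [HasZeroObject C] [HasBinaryBiproducts C] extends ExtensionData C where
  /-- `s` is a realization. -/
  realization {A B Z A' B' Z' : C} {x : A ⟶ B} {y : B ⟶ Z} {δ : Ex Z A}
    {x' : A' ⟶ B'} {y' : B' ⟶ Z'} {δ' : Ex Z' A'} :
    Realizes x y δ → Realizes x' y' δ' → ∀ (a : A ⟶ A') (c : Z ⟶ Z'), push a δ = pull δ' c →
      ∃ b : B ⟶ B', x ≫ b = a ≫ x' ∧ y ≫ c = b ≫ y'
  /-- `s` is additive: split extensions. -/
  realizes_zero (A Z : C) : Realizes (biprod.inl : A ⟶ A ⊞ Z) biprod.snd (0 : Ex Z A)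
  /-- `s` is additive: direct sums. -/
  realizes_sum {A B Z A' B' Z' : C} {x : A ⟶ B} {y : B ⟶ Z} {δ : Ex Z A}
    {x' : A' ⟶ B'} {y' : B' ⟶ Z'} {δ' : Ex Z' A'} :
    Realizes x y δ → Realizes x' y' δ' → Realizes (biprod.map x x') (biprod.map y y') (extSum δ δ')
  /-- (ET3) -/
  et3 {A B Z A' B' Z' : C} {x : A ⟶ B} {y : B ⟶ Z} {δ : Ex Z A}
    {x' : A' ⟶ B'} {y' : B' ⟶ Z'} {δ' : Ex Z' A'} :
    Realizes x y δ → Realizes x' y' δ' → ∀ (a : A ⟶ A') (b : B ⟶ B'), x ≫ b = a ≫ x' →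
      ∃ c : Z ⟶ Z', push a δ = pull δ' c ∧ y ≫ c = b ≫ y'
  /-- (ET3)ᵒᵖ -/
  et3_op {A B Z A' B' Z' : C} {x : A ⟶ B} {y : B ⟶ Z} {δ : Ex Z A}
    {x' : A' ⟶ B'} {y' : B' ⟶ Z'} {δ' : Ex Z' A'} :
    Realizes x y δ → Realizes x' y' δ' → ∀ (b : B ⟶ B') (c : Z ⟶ Z'), y ≫ c = b ≫ y' →
      ∃ a : A ⟶ A', push a δ = pull δ' c ∧ x ≫ b = a ≫ x'
  /-- (ET4) -/
  et4 {A B D G F : C} {f : A ⟶ B} {f' : B ⟶ D} {δ : Ex D A}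
    {g : B ⟶ G} {g' : G ⟶ F} {δ' : Ex F B} :
    Realizes f f' δ → Realizes g g' δ' →
      ∃ (H : C) (d : D ⟶ H) (e : H ⟶ F) (h' : G ⟶ H) (δ'' : Ex H A),
        f' ≫ d = g ≫ h' ∧ h' ≫ e = g' ∧ Realizes (f ≫ g) h' δ'' ∧
        Realizes d e (push f' δ') ∧ pull δ'' d = δ ∧ push f δ'' = pull δ' e
  /-- (ET4)ᵒᵖ -/
  et4_op {A B D G F : C} {f' : D ⟶ A} {f : A ⟶ B} {δ : Ex B D}
    {g' : F ⟶ B} {g : B ⟶ G} {δ' : Ex G F} :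
    Realizes f' f δ → Realizes g' g δ' →
      ∃ (H : C) (d : D ⟶ H) (e : H ⟶ F) (h' : H ⟶ A) (δ'' : Ex G H),
        d ≫ h' = f' ∧ h' ≫ f = e ≫ g' ∧ Realizes h' (f ≫ g) δ'' ∧
        Realizes d e (pull δ g') ∧ push e δ'' = δ' ∧ push d δ = pull δ'' g

section

variable {C : Type u} [Category.{v} C] [Preadditive C] [HasZeroObject C] [HasBinaryBiproducts C]
  [ExtriangulatedCategory C]

instance : (ExtensionData.E (C := C)).Additive := ExtensionData.additive_left

instance (Z : Cᵒᵖ) : (ExtensionData.E.obj Z : C ⥤ AddCommGrpCat.{v}).Additive :=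
  ExtensionData.additive_right Z

/-- `A ⟶ B ⟶ Z` is a conflation. -/
def Conflation {A B Z : C} (x : A ⟶ B) (y : B ⟶ Z) : Prop := ∃ δ : Ex Z A, Realizes x y δ

variable (C) in
/-- The `E`-projective objects. -/
def eProjective : ObjectProperty C := fun P =>
  ∀ ⦃A B Z : C⦄ (x : A ⟶ B) (y : B ⟶ Z), Conflation x y → ∀ f : P ⟶ Z, ∃ g : P ⟶ B, g ≫ y = f

variable (C) in
/-- The `E`-injective objects. -/
def eInjective : ObjectProperty C := fun I =>
  ∀ ⦃A B Z : C⦄ (x : A ⟶ B) (y : B ⟶ Z), Conflation x y → ∀ f : A ⟶ I, ∃ g : B ⟶ I, x ≫ g = f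

variable (C) in
/-- Every object `Z` admits a conflation `A ⟶ P ⟶ Z` with `P` an `E`-projective object. -/
def EnoughEProjectives : Prop :=
  ∀ Z : C, ∃ (A P : C) (x : A ⟶ P) (y : P ⟶ Z), Conflation x y ∧ eProjective C P

variable (C) in
/-- Every object `A` admits a conflation `A ⟶ I ⟶ Z` with `I` an `E`-injective object. -/
def EnoughEInjectives : Prop :=
  ∀ A : C, ∃ (I Z : C) (x : A ⟶ I) (y : I ⟶ Z), Conflation x y ∧ eInjective C I

/-- `Cone(X, Y)`: the objects `Z` with a conflation `A ⟶ B ⟶ Z`, where `A ∈ X` and `B ∈ Y`. -/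
def ConeOf (X Y : ObjectProperty C) : ObjectProperty C := fun Z =>
  ∃ (A B : C) (x : A ⟶ B) (y : B ⟶ Z), X A ∧ Y B ∧ Conflation x y

/-- `CoCone(X, Y)`: the objects `A` with a conflation `A ⟶ B ⟶ Z`, where `B ∈ X` and `Z ∈ Y`. -/
def CoConeOf (X Y : ObjectProperty C) : ObjectProperty C := fun A =>
  ∃ (B Z : C) (x : A ⟶ B) (y : B ⟶ Z), X B ∧ Y Z ∧ Conflation x y

/-- The syzygy class `Ω X`. -/
def syzygy (X : ObjectProperty C) : ObjectProperty C := CoConeOf (eProjective C) X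

/-- The cosyzygy class `Σ X`. -/
def cosyzygy (X : ObjectProperty C) : ObjectProperty C := ConeOf X (eInjective C)

/-- The objects `N` with `E(X, N) = 0`. -/
def rightPerp (X : ObjectProperty C) : ObjectProperty C := fun N =>
  ∀ W : C, X W → ∀ δ : Ex W N, δ = 0

/-- The objects `N` with `E(N, X) = 0`. -/
def leftPerp (X : ObjectProperty C) : ObjectProperty C := fun N =>
  ∀ W : C, X W → ∀ δ : Ex N W, δ = 0

/-- `X` is strongly precovering: each object `Z` admits a conflation `K ⟶ W ⟶ Z` whose second
morphism is an `X`-precover. -/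
def StronglyPrecovering (X : ObjectProperty C) : Prop :=
  ∀ Z : C, ∃ (K W : C) (i : K ⟶ W) (g : W ⟶ Z), Conflation i g ∧ X W ∧
    ∀ (W' : C) (f : W' ⟶ Z), X W' → ∃ f' : W' ⟶ W, f' ≫ g = f

/-- `X` is strongly preenveloping: each object `A` admits a conflation `A ⟶ W ⟶ L` whose first
morphism is an `X`-preenvelope. -/
def StronglyPreenveloping (X : ObjectProperty C) : Prop :=
  ∀ A : C, ∃ (W L : C) (g : A ⟶ W) (p : W ⟶ L), Conflation g p ∧ X W ∧
    ∀ (W' : C) (f : A ⟶ W'), X W' → ∃ f' : W ⟶ W', g ≫ f' = f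

/-- `2`-cluster tilting subcategories. -/
class IsTwoClusterTilting (X : ObjectProperty C) : Prop where
  precovering : StronglyPrecovering X
  preenveloping : StronglyPreenveloping X
  eq_rightPerp : X = rightPerp X
  eq_leftPerp : X = leftPerp X

/-! ### Stable and costable categories, and the functors `F` and `K` -/

lemma ex_eq_zero {X : ObjectProperty C} [IsTwoClusterTilting X] {Z A : C} (hZ : X Z) (hA : X A)
    (δ : Ex Z A) : δ = 0 := by
  rw [IsTwoClusterTilting.eq_rightPerp (X := X)] at hA
  exact hA Z hZ δ

lemma push_comp {Z A B D : C} (a : A ⟶ B) (b : B ⟶ D) (δ : Ex Z A) :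
    push (a ≫ b) δ = push b (push a δ) := by
  simp [push]

lemma push_zero' {Z A B : C} (a : A ⟶ B) : push a (0 : Ex Z A) = 0 := by
  simp [push]

lemma pull_zero' {Z Z' A : C} (c : Z' ⟶ Z) : pull (0 : Ex Z A) c = 0 := by
  simp [pull]

lemma pull_comp {Z Z' Z'' A : C} (c : Z' ⟶ Z) (d : Z'' ⟶ Z') (δ : Ex Z A) :
    pull δ (d ≫ c) = pull (pull δ c) d := by
  simp [pull]

lemma push_add' {Z A B : C} (a b : A ⟶ B) (δ : Ex Z A) :
    push (a + b) δ = push a δ + push b δ := by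
  simp [push, Functor.map_add]

instance (X : ObjectProperty C) [IsTwoClusterTilting X] : ClosedUnderFiniteCoproducts X where
  zero Z hZ := by
    rw [IsTwoClusterTilting.eq_rightPerp (X := X)]
    intro W _ δ
    have h := push_comp (𝟙 Z) (𝟙 Z) δ
    have h0 : ((ExtensionData.E.obj (op W)).map (𝟙 Z)) δ = 0 := by
      rw [hZ.eq_of_src (𝟙 Z) 0, Functor.map_zero]
      rfl
    simpa using h0
  biprod A B hA hB := by
    rw [IsTwoClusterTilting.eq_rightPerp (X := X)]
    intro W hW δ
    have h : push (𝟙 (A ⊞ B)) δ = δ := by simp [push]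
    rw [← h, ← biprod.total, push_add', push_comp, push_comp,
      ex_eq_zero hW hA (push biprod.fst δ), ex_eq_zero hW hB (push biprod.snd δ),
      push_zero', push_zero', add_zero]

variable (C) in
/-- The ideal of the `E`-projective morphisms: those `f` with `E(f, -) = 0`. -/
def projIdeal : AddIdeal C where
  carrier A B :=
    { carrier := {f | ExtensionData.E.map f.op = 0}
      zero_mem' := by simp
      add_mem' := by
        intro f g (hf : ExtensionData.E.map f.op = 0) (hg : ExtensionData.E.map g.op = 0)
        change ExtensionData.E.map (f + g).op = 0
        rw [op_add, Functor.map_add, hf, hg, add_zero]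
      neg_mem' := by
        intro f (hf : ExtensionData.E.map f.op = 0)
        change ExtensionData.E.map (-f).op = 0
        rw [op_neg, Functor.map_neg, hf, neg_zero] }
  precomp_mem f g hg := by
    change ExtensionData.E.map (f ≫ g).op = 0
    have hg' : ExtensionData.E.map g.op = 0 := hg
    rw [op_comp, Functor.map_comp, hg', zero_comp]
  postcomp_mem g hf := by
    rename_i f
    change ExtensionData.E.map (f ≫ g).op = 0
    have hf' : ExtensionData.E.map f.op = 0 := hf
    rw [op_comp, Functor.map_comp, hf', comp_zero]

variable (C) in
/-- The ideal of the `E`-injective morphisms: those `f` with `E(-, f) = 0`. -/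
def injIdeal : AddIdeal C where
  carrier A B :=
    { carrier := {f | ∀ Z : Cᵒᵖ, (ExtensionData.E.obj Z).map f = 0}
      zero_mem' := by simp
      add_mem' := by
        intro f g hf hg Z
        rw [Functor.map_add, hf Z, hg Z, add_zero]
      neg_mem' := by
        intro f hf Z
        rw [Functor.map_neg, hf Z, neg_zero] }
  precomp_mem f g hg Z := by rw [Functor.map_comp, hg Z, comp_zero]
  postcomp_mem g hf Z := by rw [Functor.map_comp, hf Z, zero_comp]

/-- The stable category of `X`. -/
abbrev Stable (X : ObjectProperty C) := ((projIdeal C).restrict X).Quot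

/-- The costable category of `X`. -/
abbrev Costable (X : ObjectProperty C) := ((injIdeal C).restrict X).Quot

/-- The quotient category `C / [X]`. -/
abbrev QuotBy (X : ObjectProperty C) [ClosedUnderFiniteCoproducts X] := (factorIdeal X).Quot

/-- The class `P / [X]` of the objects of `C / [X]` that are given by objects of `P`. -/
def quotClass (X : ObjectProperty C) [ClosedUnderFiniteCoproducts X] (P : ObjectProperty C) :
    ObjectProperty (QuotBy X) := fun A => P A.as

end

section

variable {C : Type u} [Category.{v} C] [Preadditive C] [HasZeroObject C] [HasBinaryBiproducts C]
  [ExtriangulatedCategory C]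

/-- The functor induced by `E(-, M)` on the stable category of `X`. -/
def extLeft (X : ObjectProperty C) (M : C) : (Stable X)ᵒᵖ ⥤ AddCommGrpCat.{v} :=
  (CategoryTheory.Quotient.lift ((projIdeal C).restrict X).rel
    (X.ι.op ⋙ ExtensionData.E.flip.obj M).rightOp (by
      intro A B f g h
      have h' : ExtensionData.E.map (f.hom - g.hom).op = 0 := h
      rw [op_sub, Functor.map_sub, sub_eq_zero] at h'
      apply Quiver.Hom.unop_inj
      exact congrArg (fun t => NatTrans.app t M) h')).leftOp

/-- The functor induced by `E(M, -)` on the costable category of `X`. -/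
def extRight (X : ObjectProperty C) (M : C) : Costable X ⥤ AddCommGrpCat.{v} :=
  CategoryTheory.Quotient.lift ((injIdeal C).restrict X).rel
    (X.ι ⋙ ExtensionData.E.obj (op M)) (by
      intro A B f g h
      have h' : (ExtensionData.E.obj (op M)).map (f.hom - g.hom) = 0 := h (op M)
      rw [Functor.map_sub, sub_eq_zero] at h'
      exact h')

instance (X : ObjectProperty C) (M : C) : (extLeft X M).Additive where
  map_add {A B f g} := by
    obtain ⟨f, rfl⟩ : ∃ t, f = Quiver.Hom.op t := ⟨f.unop, rfl⟩
    obtain ⟨g, rfl⟩ : ∃ t, g = Quiver.Hom.op t := ⟨g.unop, rfl⟩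
    obtain ⟨f, rfl⟩ := ((projIdeal C).restrict X).proj.map_surjective f
    obtain ⟨g, rfl⟩ := ((projIdeal C).restrict X).proj.map_surjective g
    have h : ExtensionData.E.map (f.hom + g.hom).op
      = ExtensionData.E.map f.hom.op + ExtensionData.E.map g.hom.op := by
      rw [op_add, Functor.map_add]
    exact congrArg (fun t => NatTrans.app t M) h

instance (X : ObjectProperty C) (M : C) : (extRight X M).Additive where
  map_add {A B f g} := by
    obtain ⟨f, rfl⟩ := ((injIdeal C).restrict X).proj.map_surjective f
    obtain ⟨g, rfl⟩ := ((injIdeal C).restrict X).proj.map_surjective g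
    exact Functor.map_add (ExtensionData.E.obj (op M)) (f := f.hom) (g := g.hom)

/-- The functor `H`, sending `M` to the right module `E(-, M)` over the stable category of `X`. -/
def functorH (X : ObjectProperty C) : C ⥤ RightMod (Stable X) where
  obj M := AdditiveFunctor.of (extLeft X M)
  map {M N} h := ObjectProperty.homMk
    { app := fun Y => (ExtensionData.E.obj (op Y.unop.as.obj)).map h
      naturality := by
        intro A B f
        obtain ⟨f, rfl⟩ : ∃ t, f = Quiver.Hom.op t := ⟨f.unop, rfl⟩
        obtain ⟨f, rfl⟩ := ((projIdeal C).restrict X).proj.map_surjective f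
        exact ((ExtensionData.E.map f.hom.op).naturality h).symm }
  map_id M := by
    apply ObjectProperty.hom_ext
    ext Y : 2
    exact (ExtensionData.E.obj (op Y.unop.as.obj)).map_id M
  map_comp f g := by
    apply ObjectProperty.hom_ext
    ext Y : 2
    exact (ExtensionData.E.obj (op Y.unop.as.obj)).map_comp f g

/-- The contravariant functor `G`, sending `M` to the left module `E(M, -)` over the costable
category of `X`. -/
def functorG (X : ObjectProperty C) : Cᵒᵖ ⥤ LeftMod (Costable X) where
  obj M := AdditiveFunctor.of (extRight X M.unop)
  map {M N} h := ObjectProperty.homMk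
    { app := fun Y => (ExtensionData.E.map h).app Y.as.obj
      naturality := by
        intro A B f
        obtain ⟨f, rfl⟩ := ((injIdeal C).restrict X).proj.map_surjective f
        exact (ExtensionData.E.map h).naturality f.hom }
  map_id M := by
    apply ObjectProperty.hom_ext
    ext Y : 2
    exact congrArg (fun t => NatTrans.app t Y.as.obj) (ExtensionData.E.map_id M)
  map_comp f g := by
    apply ObjectProperty.hom_ext
    ext Y : 2
    exact congrArg (fun t => NatTrans.app t Y.as.obj) (ExtensionData.E.map_comp f g)

instance (X : ObjectProperty C) : (functorH X).Additive where
  map_add {M N f g} := by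
    apply ObjectProperty.hom_ext
    ext Y : 2
    exact (ExtensionData.E.obj (op Y.unop.as.obj)).map_add

instance (X : ObjectProperty C) : (functorG X).Additive where
  map_add {M N f g} := by
    apply ObjectProperty.hom_ext
    ext Y : 2
    exact congrArg (fun t => NatTrans.app t Y.as.obj) (ExtensionData.E.map_add (f := f) (g := g))

lemma push_factor_eq_zero {X : ObjectProperty C} [IsTwoClusterTilting X] {Y W M N : C}
    (hY : X Y) (hW : X W) (a : M ⟶ W) (b : W ⟶ N) (δ : Ex Y M) : push (a ≫ b) δ = 0 := by
  rw [push_comp, ex_eq_zero hY hW (push a δ), push_zero']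

lemma pull_factor_eq_zero {X : ObjectProperty C} [IsTwoClusterTilting X] {Y W M N : C}
    (hW : X W) (hY : X Y) (a : M ⟶ W) (b : W ⟶ N) (δ : Ex N Y) : pull δ (a ≫ b) = 0 := by
  rw [pull_comp, ex_eq_zero hW hY (pull δ b), pull_zero']

/-- The functor `F : C / [X] ⥤ Mod` induced by `H`. -/
def functorF (X : ObjectProperty C) [IsTwoClusterTilting X] :
    QuotBy X ⥤ RightMod (Stable X) :=
  CategoryTheory.Quotient.lift (factorIdeal X).rel (functorH X) (by
    rintro M N f g ⟨W, hW, a, b, hab⟩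
    rw [← sub_eq_zero, ← Functor.map_sub, ← hab]
    apply ObjectProperty.hom_ext
    ext Y δ
    exact push_factor_eq_zero Y.unop.as.property hW a b δ)

/-- The contravariant functor `K` from `C / [X]` to left modules induced by `G`. -/
def functorK (X : ObjectProperty C) [IsTwoClusterTilting X] :
    (QuotBy X)ᵒᵖ ⥤ LeftMod (Costable X) :=
  (CategoryTheory.Quotient.lift (factorIdeal X).rel (functorG X).rightOp (by
    rintro M N f g ⟨W, hW, a, b, hab⟩
    apply Quiver.Hom.unop_inj
    change (functorG X).map f.op = (functorG X).map g.op
    rw [← sub_eq_zero, ← Functor.map_sub, ← op_sub, ← hab]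
    apply ObjectProperty.hom_ext
    ext Y δ
    exact pull_factor_eq_zero hW Y.as.property a b δ)).leftOp

instance (X : ObjectProperty C) [IsTwoClusterTilting X] : (functorF X).Additive where
  map_add {M N f g} := by
    obtain ⟨f, rfl⟩ := (factorIdeal X).proj.map_surjective f
    obtain ⟨g, rfl⟩ := (factorIdeal X).proj.map_surjective g
    exact Functor.map_add (functorH X) (f := f) (g := g)

instance (X : ObjectProperty C) [IsTwoClusterTilting X] : (functorK X).Additive where
  map_add {M N f g} := by
    obtain ⟨f, rfl⟩ : ∃ t, f = Quiver.Hom.op t := ⟨f.unop, rfl⟩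
    obtain ⟨g, rfl⟩ : ∃ t, g = Quiver.Hom.op t := ⟨g.unop, rfl⟩
    obtain ⟨f, rfl⟩ := (factorIdeal X).proj.map_surjective f
    obtain ⟨g, rfl⟩ := (factorIdeal X).proj.map_surjective g
    exact Functor.map_add (functorG X) (f := f.op) (g := g.op)

/-- The class `ε_F` of the sequences in `C / [X]` that `F` sends to short exact sequences. -/
def epsF (X : ObjectProperty C) [IsTwoClusterTilting X] :
    ObjectProperty (ShortComplex (QuotBy X)) :=
  fun S => modShortExact (S.map (functorF X))

/-- The class `ε_K` of the sequences in `C / [X]` that `K` sends to short exact sequences. -/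
def epsK (X : ObjectProperty C) [IsTwoClusterTilting X] :
    ObjectProperty (ShortComplex (QuotBy X)) :=
  fun S => modShortExact (S.op.map (functorK X))

/-- The exact structure on finitely presented left modules induced by the short exact sequences
of modules. -/
def epsFp (Z : Type u) [Category.{v} Z] [Preadditive Z] :
    ObjectProperty (ShortComplex (leftFp Z).FullSubcategory) :=
  fun S => modShortExact (S.map (leftFp Z).ι)

end

end Extri

end

open Extri

/-!
The theorem is proved by embedding `C / [X]` fully faithfully in a category of functors to abelian
groups, twice: by `F`, covariantly, and by `K`, contravariantly.

The axioms of an extriangulated category give, for each conflation, two exact sequences of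
`Hom`-groups and `E`-groups (`Realizes.exists_lift` to `Realizes.exists_pull_snd_eq`). Since `X` is
2-cluster tilting, each object `M` has a coresolution `M ⟶ W ⟶ L` and a resolution `K ⟶ W ⟶ M` by
objects of `X`. The extension `δ ∈ E(L, M)` of the coresolution generates `E(-, M)` on `X`, a morphism
`M ⟶ N` factors through `X` if and only if it kills `δ`, and each natural transformation from
`E(-, M)` to `E(-, N)` is determined by the image of `δ`, which has the form `m · δ`; so `F` is fully
faithful, and dually so is `K`.

Pulling back a resolution of `N` along `m : M ⟶ N` gives a morphism `k : K ⟶ M` which both functors see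
as a kernel of `m`: `F k` is an objectwise kernel of `F m`, and `K k` an objectwise cokernel of `K m`
(`exists_kernel`); pushing out a coresolution of `M` gives a cokernel (`exists_cokernel`). Exactness
at the middle term comes from the octahedral axiom (`Realizes.exists_push_eq_of_pull`,
`Realizes.exists_pull_eq_of_push`). Hence the essential images of both functors are closed under
kernels and cokernels in an abelian category of functors, `C / [X]` is abelian, and both functors
preserve and reflect short exact sequences (`epsF_iff`, `epsK_iff`). In particular the exact
structures in the statement are those of all short exact sequences of an abelian category.

The last conflation `W ⟶ L` of a coresolution presents `F M`, so `F M` is finitely presented. The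
image of a syzygy of `L ∈ X` is the functor represented by `L` in the stable category
(`isIso_yonedaHom`), and the essential image is closed under cokernels, so `F` reaches every finitely
presented module.

A syzygy `A` of `Y ∈ X` is projective in `C / [X]`, as `Hom(A, -)` is isomorphic to `E(Y, -)` there,
and every `M` is a quotient of a syzygy of `L`; splitting such an epimorphism describes the
projective objects. In the Krull–Schmidt case `L` is decomposed first, which makes every projective
object a direct summand of a finite sum of syzygies whose endomorphism rings, as quotients of local
rings, are local or zero; by Azumaya's argument (`mem_of_biprod_iso_biproduct`) such a summand is
itself a finite sum of syzygies. The injective objects are treated dually.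
-/

noncomputable section

namespace Extri

/-! ### Full subcategories of abelian categories -/

section EssImage

variable {D : Type*} [Category* D] {A : Type*} [Category* A] [Abelian A] (F : D ⥤ A) [F.Full]

lemma essImage_closedUnderKernels
    (h : ∀ ⦃M N : D⦄ (f : M ⟶ N), ∃ (K : D) (k : K ⟶ M) (w : F.map k ≫ F.map f = 0),
      (ShortComplex.mk _ _ w).Exact ∧ Mono (F.map k)) : F.essImage.IsClosedUnderKernels where
  kernels_le := by
    rintro _ ⟨f, c, hc, ⟨⟨M, ⟨e⟩⟩, ⟨N, ⟨e'⟩⟩⟩⟩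
    obtain ⟨K, k, w, hk, hm⟩ := h (F.preimage (e.hom ≫ f ≫ e'.inv))
    have w' : (F.map k ≫ e.hom) ≫ f = 0 := by
      have := w =≫ e'.hom
      simpa using this
    have ex : (ShortComplex.mk _ _ w').Exact :=
      ShortComplex.exact_of_iso (S₁ := .mk _ _ w) (S₂ := .mk _ _ w')
        (ShortComplex.isoMk (Iso.refl _) e e') hk
    have : Mono (ShortComplex.mk _ _ w').f := mono_comp _ _
    exact ⟨K, ⟨ex.fIsKernel.conePointUniqueUpToIso hc⟩⟩

lemma essImage_closedUnderCokernels
    (h : ∀ ⦃M N : D⦄ (f : M ⟶ N), ∃ (Q : D) (q : N ⟶ Q) (w : F.map f ≫ F.map q = 0),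
      (ShortComplex.mk _ _ w).Exact ∧ Epi (F.map q)) : F.essImage.IsClosedUnderCokernels where
  cokernels_le := by
    rintro _ ⟨f, c, hc, ⟨⟨M, ⟨e⟩⟩, ⟨N, ⟨e'⟩⟩⟩⟩
    obtain ⟨Q, q, w, hq, hm⟩ := h (F.preimage (e.hom ≫ f ≫ e'.inv))
    have w' : f ≫ e'.inv ≫ F.map q = 0 := by
      have := e.inv ≫= w
      simpa using this
    have ex : (ShortComplex.mk _ _ w').Exact :=
      ShortComplex.exact_of_iso (S₁ := .mk _ _ w) (S₂ := .mk _ _ w')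
        (ShortComplex.isoMk e e' (Iso.refl _)) hq
    have : Epi (ShortComplex.mk _ _ w').g := epi_comp _ _
    exact ⟨Q, ⟨ex.gIsCokernel.coconePointUniqueUpToIso hc⟩⟩

end EssImage

section EssImage

variable {D : Type*} [Category* D] [Preadditive D] {A : Type*} [Category* A] [Abelian A]
  (F : D ⥤ A) [F.Additive]

lemma essImage_containsZero [HasZeroObject D] : F.essImage.ContainsZero where
  exists_zero := ⟨F.obj 0, F.map_isZero (isZero_zero D), F.obj_mem_essImage 0⟩

lemma essImage_closedUnderFiniteProducts [HasZeroObject D] [HasBinaryBiproducts D] :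
    F.essImage.IsClosedUnderFiniteProducts := by
  have := essImage_containsZero F
  have : F.essImage.IsClosedUnderBinaryProducts := by
    refine .mk' ?_
    rintro _ ⟨G, hG⟩
    obtain ⟨M, ⟨e⟩⟩ := hG ⟨.left⟩
    obtain ⟨N, ⟨e'⟩⟩ := hG ⟨.right⟩
    have := preservesBinaryBiproducts_of_preservesBiproducts F
    refine ⟨M ⊞ N, ⟨F.mapBiprod M N ≪≫ biprod.isoProd _ _ ≪≫
      HasLimit.isoOfNatIso (mapPairIso e e')⟩⟩
  exact .mk'

lemma sigma_mem_essImage [HasZeroObject D] [HasBinaryBiproducts D] {n : ℕ} (f : Fin n → A)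
    (h : ∀ i, F.essImage (f i)) : F.essImage (∐ f) := by
  have := essImage_closedUnderFiniteProducts F
  have := Abelian.hasFiniteBiproducts (C := A)
  exact F.essImage.prop_of_iso ((biproduct.isoProduct f).symm ≪≫ biproduct.isoCoproduct f)
    (F.essImage.prop_product h)

variable [F.Full] [F.Faithful] [HasZeroObject D] [HasBinaryBiproducts D] [F.essImage.IsClosedUnderKernels]
  [F.essImage.IsClosedUnderCokernels]

/-- A preadditive category that embeds fully faithfully in an abelian category, with an essential
image closed under kernels, cokernels and finite products, is abelian. -/
@[reducible]
def abelianOfEssImage : Abelian D :=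
  have := essImage_containsZero F
  have := essImage_closedUnderFiniteProducts F
  have := HasFiniteBiproducts.of_hasFiniteProducts (C := A)
  have : HasFiniteProducts D := hasFiniteProducts_of_has_binary_and_terminal
  abelianOfEquivalence F.toEssImage

lemma preservesFiniteLimits_of_essImage : PreservesFiniteLimits F := by
  have := essImage_containsZero F
  have := essImage_closedUnderFiniteProducts F
  have : PreservesFiniteLimits F.essImage.ι := by
    have := fun (X Y : F.essImage.FullSubcategory) (f : X ⟶ Y) =>
      F.essImage.preservesKernels_ι f
    exact Functor.preservesFiniteLimits_of_preservesKernels _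
  exact preservesFiniteLimits_of_natIso F.toEssImageCompι

lemma preservesFiniteColimits_of_essImage : PreservesFiniteColimits F := by
  have := essImage_containsZero F
  have := essImage_closedUnderFiniteProducts F
  have : PreservesFiniteColimits F.essImage.ι := by
    have := fun (X Y : F.essImage.FullSubcategory) (f : X ⟶ Y) =>
      F.essImage.preservesCokernels_ι f
    exact Functor.preservesFiniteColimits_of_preservesCokernels _
  exact preservesFiniteColimits_of_natIso F.toEssImageCompι

lemma shortExact_map_iff_of_essImage (S : ShortComplex D) :
    (S.map F).ShortExact ↔ S.ShortExact := by
  let := abelianOfEssImage F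
  have := preservesFiniteLimits_of_essImage F
  have := preservesFiniteColimits_of_essImage F
  exact ShortExact.shortExact_map_iff F

end EssImage

/-! ### Exact sequences of functors to abelian groups -/

section Pointwise

variable {J : Type*} [Category* J]

lemma exact_iff_app {F G H : J ⥤ AddCommGrpCat.{v}} (f : F ⟶ G) (g : G ⟶ H) (w : f ≫ g = 0) :
    (ShortComplex.mk f g w).Exact ↔
      ∀ (j : J) (x : G.obj j), g.app j x = 0 → ∃ y, f.app j y = x := by
  rw [ShortComplex.exact_iff_isZero_homology, Functor.isZero_iff]
  refine forall_congr' fun j => ?_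
  exact (ShortComplex.mapHomologyIso (.mk f g w)
    ((evaluation J AddCommGrpCat).obj j)).isZero_iff.symm.trans
      ((ShortComplex.exact_iff_isZero_homology _).symm.trans (ShortComplex.ab_exact_iff _))

lemma mono_iff_app {F G : J ⥤ AddCommGrpCat.{v}} (f : F ⟶ G) :
    Mono f ↔ ∀ (j : J) (x : F.obj j), f.app j x = 0 → x = 0 := by
  simp only [NatTrans.mono_iff_mono_app, AddCommGrpCat.mono_iff_injective]
  exact forall_congr' fun j => injective_iff_map_eq_zero (f.app j).hom

lemma epi_iff_app {F G : J ⥤ AddCommGrpCat.{v}} (f : F ⟶ G) :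
    Epi f ↔ ∀ j, Function.Surjective (f.app j) := by
  simp only [NatTrans.epi_iff_epi_app, AddCommGrpCat.epi_iff_surjective]

end Pointwise

/-! ### Finitely presented modules -/

section Presentations

/-- An object with a presentation by `R p` and `R q` is the cokernel of a morphism between coproducts
indexed by one-element families. -/
lemma exists_sigma_presentation {A Z : Type*} [Category* A] [Abelian A] (R : Z → A) {p q : Z} {M : A}
    (f : R p ⟶ R q) (g : R q ⟶ M) (w : f ≫ g = 0) (h : (ShortComplex.mk f g w).Exact) (hg : Epi g) :
    ∃ (m n : ℕ) (P : Fin m → Z) (Q : Fin n → Z)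
      (f : (∐ fun i => R (P i)) ⟶ (∐ fun j => R (Q j))), Nonempty (M ≅ cokernel f) := by
  have : Epi (ShortComplex.mk f g w).g := hg
  let e := coproductUniqueIso (fun _ : Fin 1 => R p)
  let e' := coproductUniqueIso (fun _ : Fin 1 => R q)
  refine ⟨1, 1, fun _ => p, fun _ => q, e.hom ≫ f ≫ e'.inv, ⟨?_⟩⟩
  exact h.gIsCokernel.coconePointUniqueUpToIso (cokernelIsCokernel f) ≪≫
    (cokernel.mapIso (e.hom ≫ f ≫ e'.inv) f e e' (by simp)).symm

variable {Z : Type u} [Category.{v} Z] [Preadditive Z]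

/-- The morphism `Z(-, L) ⟶ G` that corresponds to an element of `G L`. -/
def yonedaHom (G : Zᵒᵖ ⥤ AddCommGrpCat.{v}) [G.Additive] {L : Z} (x : G.obj (op L)) :
    preadditiveYoneda.obj L ⟶ G where
  app Y := AddCommGrpCat.ofHom (AddMonoidHom.mk' (fun c : Y.unop ⟶ L => G.map c.op x) (by
    intro c d
    exact ConcreteCategory.congr_hom (G.map_add (f := Quiver.Hom.op (X := Y.unop) (Y := L) c)
      (g := Quiver.Hom.op (X := Y.unop) (Y := L) d)) x))
  naturality Y Y' f := by
    ext c
    exact ConcreteCategory.congr_hom (G.map_comp (Quiver.Hom.op (X := unop Y) (Y := L) c) f) x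

/-- The morphism `Z(L, -) ⟶ G` that corresponds to an element of `G L`. -/
def coyonedaHom (G : Z ⥤ AddCommGrpCat.{v}) [G.Additive] {L : Z} (x : G.obj L) :
    preadditiveCoyoneda.obj (op L) ⟶ G where
  app Y := AddCommGrpCat.ofHom (AddMonoidHom.mk' (fun c : L ⟶ Y => G.map c x) (by
    intro c d
    exact ConcreteCategory.congr_hom (G.map_add (X := L) (f := c) (g := d)) x))
  naturality Y Y' f := by
    ext c
    exact ConcreteCategory.congr_hom (G.map_comp (X := L) c f) x

/-- A module `G` generated by `x ∈ G L`, such that the morphisms that kill `x` are those that factor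
through `w`, is finitely presented. -/
lemma rightFp_of_generator (G : Zᵒᵖ ⥤+ AddCommGrpCat.{v}) {W L : Z} (w : W ⟶ L)
    (x : G.obj.obj (op L)) (hx : ∀ (Y : Z) (y : G.obj.obj (op Y)), ∃ c : Y ⟶ L, G.obj.map c.op x = y)
    (hw : G.obj.map w.op x = 0)
    (h : ∀ (Y : Z) (c : Y ⟶ L), G.obj.map c.op x = 0 → ∃ d : Y ⟶ W, d ≫ w = c) : rightFp Z G := by
  refine exists_sigma_presentation (fun P : Z => preadditiveYoneda.obj P) (preadditiveYoneda.map w)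
    (yonedaHom G.obj x) ?_ ((exact_iff_app _ _ _).2 fun Y c hc => h Y.unop c hc)
    ((epi_iff_app _).2 fun Y y => hx Y.unop y)
  ext Y c
  have := ConcreteCategory.congr_hom (G.obj.map_comp w.op (Quiver.Hom.op (X := unop Y) (Y := W) c)) x
  refine this.trans ?_
  rw [AddCommGrpCat.comp_apply, hw, map_zero]
  rfl

/-- A module `G` generated by `x ∈ G L`, such that the morphisms that kill `x` are those that factor
through `w`, is finitely presented. -/
lemma leftFp_of_generator (G : Z ⥤+ AddCommGrpCat.{v}) {W L : Z} (w : L ⟶ W)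
    (x : G.obj.obj L) (hx : ∀ (Y : Z) (y : G.obj.obj Y), ∃ c : L ⟶ Y, G.obj.map c x = y)
    (hw : G.obj.map w x = 0)
    (h : ∀ (Y : Z) (c : L ⟶ Y), G.obj.map c x = 0 → ∃ d : W ⟶ Y, w ≫ d = c) : leftFp Z G := by
  refine exists_sigma_presentation (fun P : Z => preadditiveCoyoneda.obj (op P))
    (preadditiveCoyoneda.map w.op)
    (coyonedaHom G.obj x) ?_ ((exact_iff_app _ _ _).2 fun Y c hc => h Y c hc)
    ((epi_iff_app _).2 fun Y y => hx Y y)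
  ext Y c
  have := ConcreteCategory.congr_hom (G.obj.map_comp w (Z := Y) c) x
  refine this.trans ?_
  rw [AddCommGrpCat.comp_apply, hw, map_zero]
  rfl

lemma isIso_of_app_bijective {J : Type*} [Category* J] {F G : J ⥤ AddCommGrpCat.{v}} (f : F ⟶ G)
    (hi : ∀ (j : J) (x : F.obj j), f.app j x = 0 → x = 0) (hs : ∀ j, Function.Surjective (f.app j)) :
    IsIso f := by
  have := (mono_iff_app f).2 hi
  have := (epi_iff_app f).2 hs
  exact isIso_of_mono_of_epi f

end Presentations

/-! ### The exact structure of an abelian category -/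

section

variable {D : Type u} [Category.{v} D] [Abelian D]

lemma admissibleMono_iff {A B : D} {i : A ⟶ B} :
    AdmissibleMono (fun S => S.ShortExact) i ↔ Mono i := by
  refine ⟨fun ⟨_, _, _, h⟩ => h.mono_f, fun h => ⟨_, cokernel.π i, cokernel.condition i, ?_⟩⟩
  exact .mk' (ShortComplex.cokernelSequence_exact i) h (inferInstanceAs (Epi (cokernel.π i)))

lemma admissibleEpi_iff {A B : D} {p : A ⟶ B} :
    AdmissibleEpi (fun S => S.ShortExact) p ↔ Epi p := by
  refine ⟨fun ⟨_, _, _, h⟩ => h.epi_g, fun h => ⟨_, kernel.ι p, kernel.condition p, ?_⟩⟩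
  exact .mk' (ShortComplex.kernelSequence_exact p) (inferInstanceAs (Mono (kernel.ι p))) h

end

lemma isExactCategory_shortExact {D : Type u} [Category.{v} D] [Abelian D] :
    IsExactCategory (D := D) (fun S => S.ShortExact) where
  additive := Abelian.hasFiniteBiproducts
  iso_closed := ⟨fun e h => ShortComplex.shortExact_of_iso e h⟩
  isKernel S h := by
    have := h.mono_f
    exact ⟨h.exact.fIsKernel⟩
  isCokernel S h := by
    have := h.epi_g
    exact ⟨h.exact.gIsCokernel⟩
  id_mono A := ⟨0, 0, by simp, .mk' ((ShortComplex.exact_iff_epi _ rfl).2 inferInstance)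
    inferInstance (by dsimp; infer_instance)⟩
  id_epi A := ⟨0, 0, by simp, .mk' ((ShortComplex.exact_iff_mono _ rfl).2 inferInstance)
    (by dsimp; infer_instance) inferInstance⟩
  comp_mono i j hi hj := by
    rw [admissibleMono_iff] at *
    exact mono_comp i j
  comp_epi p q hp hq := by
    rw [admissibleEpi_iff] at *
    exact epi_comp p q
  pushout i f hi := by
    rw [admissibleMono_iff] at hi
    exact ⟨_, pushout.inl i f, pushout.inr i f, .of_hasPushout i f,
      admissibleMono_iff.2 inferInstance⟩
  pullback p f hp := by
    rw [admissibleEpi_iff] at hp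
    exact ⟨_, pullback.fst p f, pullback.snd p f, .of_hasPullback p f,
      admissibleEpi_iff.2 inferInstance⟩

/-! ### Exact sequences in an extriangulated category -/

section ExactSequences

variable {C : Type u} [Category.{v} C] [Preadditive C] [HasZeroObject C] [HasBinaryBiproducts C]
  [ExtriangulatedCategory C]

lemma push_id {Z A : C} (δ : Ex Z A) : push (𝟙 A) δ = δ := by
  simp [push]

lemma pull_id {Z A : C} (δ : Ex Z A) : pull δ (𝟙 Z) = δ := by
  simp [pull]

lemma push_sub {Z A B : C} (a b : A ⟶ B) (δ : Ex Z A) :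
    push (a - b) δ = push a δ - push b δ := by
  simp [push, Functor.map_sub]

lemma pull_sub {Z Z' A : C} (δ : Ex Z A) (c d : Z' ⟶ Z) :
    pull δ (c - d) = pull δ c - pull δ d := by
  simp only [pull, op_sub, Functor.map_sub]
  rfl

lemma push_pull {Z Z' A A' : C} (a : A ⟶ A') (δ : Ex Z A) (c : Z' ⟶ Z) :
    push a (pull δ c) = pull (push a δ) c :=
  (ConcreteCategory.congr_hom ((ExtensionData.E.map c.op).naturality a) δ).symm

lemma exists_realizes {Z A : C} (δ : Ex Z A) :
    ∃ (B : C) (x : A ⟶ B) (y : B ⟶ Z), Realizes x y δ := by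
  obtain ⟨⟨B, x, y⟩, h⟩ := Quotient.exists_rep (ExtensionData.s δ)
  exact ⟨B, x, y, h.symm⟩

section

variable {A B Z : C} {x : A ⟶ B} {y : B ⟶ Z} {δ : Ex Z A}

lemma Realizes.pull_snd (h : Realizes x y δ) : pull δ y = 0 := by
  obtain ⟨a, ha, -⟩ := ExtriangulatedCategory.et3_op
    (ExtriangulatedCategory.realizes_zero A B) h biprod.snd y rfl
  rw [← ha, push_zero']

lemma Realizes.push_fst (h : Realizes x y δ) : push x δ = 0 := by
  obtain ⟨c, hc, -⟩ := ExtriangulatedCategory.et3 h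
    (ExtriangulatedCategory.realizes_zero B Z) x biprod.inl rfl
  rw [hc, pull_zero']

/-- Exactness of `C(Y, B) ⟶ C(Y, Z) ⟶ E(Y, A)`. -/
lemma Realizes.exists_lift (h : Realizes x y δ) {Y : C} (c : Y ⟶ Z) (hc : pull δ c = 0) :
    ∃ b : Y ⟶ B, b ≫ y = c := by
  obtain ⟨b, -, hb⟩ := ExtriangulatedCategory.realization
    (ExtriangulatedCategory.realizes_zero A Y) h (𝟙 A) c (by rw [hc, push_zero'])
  exact ⟨biprod.inr ≫ b, by simp [← hb]⟩

/-- Exactness of `C(B, Y) ⟶ C(A, Y) ⟶ E(Z, Y)`. -/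
lemma Realizes.exists_desc (h : Realizes x y δ) {Y : C} (a : A ⟶ Y) (ha : push a δ = 0) :
    ∃ b : B ⟶ Y, x ≫ b = a := by
  obtain ⟨b, hb, -⟩ := ExtriangulatedCategory.realization h
    (ExtriangulatedCategory.realizes_zero Y Z) a (𝟙 Z) (by rw [ha, pull_zero'])
  exact ⟨b ≫ biprod.fst, by simp [reassoc_of% hb]⟩

/-- Exactness of `C(Y, Z) ⟶ E(Y, A) ⟶ E(Y, B)`. -/
lemma Realizes.exists_pull_eq (h : Realizes x y δ) {Y : C} (θ : Ex Y A) (hθ : push x θ = 0) :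
    ∃ c : Y ⟶ Z, pull δ c = θ := by
  obtain ⟨U, i, p, hU⟩ := exists_realizes θ
  obtain ⟨b, hb⟩ := hU.exists_desc x hθ
  obtain ⟨c, hc, -⟩ := ExtriangulatedCategory.et3 hU h (𝟙 A) b (by rw [hb, Category.id_comp])
  exact ⟨c, by rw [← hc, push_id]⟩

/-- Exactness of `C(A, Y) ⟶ E(Z, Y) ⟶ E(B, Y)`. -/
lemma Realizes.exists_push_eq (h : Realizes x y δ) {Y : C} (θ : Ex Z Y) (hθ : pull θ y = 0) :
    ∃ a : A ⟶ Y, push a δ = θ := by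
  obtain ⟨U, i, p, hU⟩ := exists_realizes θ
  obtain ⟨b, hb⟩ := hU.exists_lift y hθ
  obtain ⟨a, ha, -⟩ := ExtriangulatedCategory.et3_op h hU b (𝟙 Z) (by rw [hb, Category.comp_id])
  exact ⟨a, by rw [ha, pull_id]⟩

/-- Exactness of `E(Y, A) ⟶ E(Y, B) ⟶ E(Y, Z)`. The octahedron on `x` and a realization of `θ`
contains a realization of `y · θ`; as this is split, its section pulls the third extension of the
octahedron back to the required one. -/
lemma Realizes.exists_push_fst_eq (h : Realizes x y δ) {Y : C} (θ : Ex Y B) (hθ : push y θ = 0) :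
    ∃ η : Ex Y A, push x η = θ := by
  obtain ⟨U, i, p, hU⟩ := exists_realizes θ
  obtain ⟨H, d, e, h', δ'', -, -, -, hde, -, hx⟩ := ExtriangulatedCategory.et4 h hU
  obtain ⟨s, hs⟩ := hde.exists_lift (𝟙 Y) (by rw [hθ, pull_zero'])
  exact ⟨pull δ'' s, by rw [push_pull, hx, ← pull_comp, hs, pull_id]⟩

/-- Exactness of `E(Z, Y) ⟶ E(B, Y) ⟶ E(A, Y)`. -/
lemma Realizes.exists_pull_snd_eq (h : Realizes x y δ) {Y : C} (θ : Ex B Y) (hθ : pull θ x = 0) :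
    ∃ η : Ex Z Y, pull η y = θ := by
  obtain ⟨U, i, p, hU⟩ := exists_realizes θ
  obtain ⟨H, d, e, h', δ'', -, -, -, hde, -, hy⟩ := ExtriangulatedCategory.et4_op hU h
  obtain ⟨s, hs⟩ := hde.exists_desc (𝟙 Y) (by rw [hθ, push_zero'])
  exact ⟨push s δ'', by rw [← push_pull, ← hy, ← push_comp, hs, push_id]⟩

/-- For a realization of the pullback of an extension `δ` along `m`, with second morphism `p`,
exactness at the middle of `E(Y, K) ⟶ E(Y, M) ⟶ E(Y, N)`. A realization of `η` extends `m` to a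
morphism `n`, and the octahedron on a realization of `n^* δ` gives the preimage of `η`. -/
lemma Realizes.exists_push_eq_of_pull {K M N H : C} {δ : Ex N H} {m : M ⟶ N} {i : H ⟶ K} {p : K ⟶ M}
    (h : Realizes i p (pull δ m)) {Y : C} (η : Ex Y M) (hη : push m η = 0) :
    ∃ ξ : Ex Y K, push p ξ = η := by
  obtain ⟨U, u, u', hU⟩ := exists_realizes η
  obtain ⟨n, hn⟩ := hU.exists_desc m hη
  obtain ⟨V, v, v', hV⟩ := exists_realizes (pull δ n)
  obtain ⟨H', d, e, h', δ'', -, -, -, hde, he, -⟩ := ExtriangulatedCategory.et4_op hV hU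
  rw [← pull_comp, hn] at hde
  obtain ⟨b, -, hb⟩ := ExtriangulatedCategory.realization hde h (𝟙 H) (𝟙 M)
    (by rw [push_id, pull_id])
  refine ⟨push b δ'', ?_⟩
  rw [← push_comp, ← hb, Category.comp_id, he]

/-- For a realization of the pushout of an extension `δ` along `m`, with first morphism `i`,
exactness at the middle of `E(Q, Y) ⟶ E(N, Y) ⟶ E(M, Y)`. -/
lemma Realizes.exists_pull_eq_of_push {Q M N H : C} {δ : Ex H M} {m : M ⟶ N} {i : N ⟶ Q} {p : Q ⟶ H}
    (h : Realizes i p (push m δ)) {Y : C} (θ : Ex N Y) (hθ : pull θ m = 0) :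
    ∃ ξ : Ex Q Y, pull ξ i = θ := by
  obtain ⟨U, u, u', hU⟩ := exists_realizes θ
  obtain ⟨n, hn⟩ := hU.exists_lift m hθ
  obtain ⟨V, v, v', hV⟩ := exists_realizes (push n δ)
  obtain ⟨H', d, e, h', δ'', -, -, -, hde, he, -⟩ := ExtriangulatedCategory.et4 hU hV
  rw [← push_comp, hn] at hde
  obtain ⟨b, hb, -⟩ := ExtriangulatedCategory.realization h hde (𝟙 N) (𝟙 H)
    (by rw [push_id, pull_id])
  refine ⟨pull δ'' b, ?_⟩
  rw [← pull_comp, hb, Category.id_comp, he]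

end

lemma eProjective.ex_eq_zero {P A : C} (hP : eProjective C P) (δ : Ex P A) : δ = 0 := by
  obtain ⟨U, i, p, hU⟩ := exists_realizes δ
  obtain ⟨g, hg⟩ := hP i p ⟨δ, hU⟩ (𝟙 P)
  rw [← pull_id δ, ← hg, pull_comp, hU.pull_snd, pull_zero']

lemma eInjective.ex_eq_zero {I Z : C} (hI : eInjective C I) (δ : Ex Z I) : δ = 0 := by
  obtain ⟨U, i, p, hU⟩ := exists_realizes δ
  obtain ⟨g, hg⟩ := hI i p ⟨δ, hU⟩ (𝟙 I)
  rw [← push_id δ, ← hg, push_comp, hU.push_fst, push_zero']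

end ExactSequences

/-! ### Approximations by a 2-cluster tilting subcategory -/

section ClusterTilting

variable {C : Type u} [Category.{v} C] [Preadditive C] [HasZeroObject C] [HasBinaryBiproducts C]
  [ExtriangulatedCategory C] {X : ObjectProperty C} [IsTwoClusterTilting X]

lemma mem_of_leftPerp {N : C} (h : ∀ W, X W → ∀ δ : Ex N W, δ = 0) : X N := by
  rw [IsTwoClusterTilting.eq_leftPerp (X := X)]
  exact h

lemma mem_of_rightPerp {N : C} (h : ∀ W, X W → ∀ δ : Ex W N, δ = 0) : X N := by
  rw [IsTwoClusterTilting.eq_rightPerp (X := X)]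
  exact h

lemma eProjective.mem {P : C} (hP : eProjective C P) : X P :=
  mem_of_leftPerp fun _ _ => hP.ex_eq_zero

lemma eInjective.mem {I : C} (hI : eInjective C I) : X I :=
  mem_of_rightPerp fun _ _ => hI.ex_eq_zero

lemma mem_of_retract {A B : C} (hB : X B) (i : A ⟶ B) (r : B ⟶ A) (h : i ≫ r = 𝟙 A) : X A :=
  mem_of_rightPerp fun W hW δ => by
    rw [← push_id δ, ← h, push_comp, ex_eq_zero hW hB (push i δ), push_zero']

variable (X)

/-- The last term of a strong preenvelope of `M` lies in `X`. -/
lemma exists_coresolution (M : C) : ∃ (W L : C) (x : M ⟶ W) (y : W ⟶ L) (δ : Ex L M),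
    Realizes x y δ ∧ X W ∧ X L := by
  obtain ⟨W, L, x, y, ⟨δ, h⟩, hW, hx⟩ := IsTwoClusterTilting.preenveloping (X := X) M
  refine ⟨W, L, x, y, δ, h, hW, mem_of_leftPerp fun W' hW' θ => ?_⟩
  obtain ⟨a, rfl⟩ := h.exists_push_eq θ (ex_eq_zero hW hW' _)
  obtain ⟨b, rfl⟩ := hx _ a hW'
  rw [push_comp, h.push_fst, push_zero']

/-- The first term of a strong precover of `M` lies in `X`. -/
lemma exists_resolution (M : C) : ∃ (K W : C) (x : K ⟶ W) (y : W ⟶ M) (δ : Ex M K),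
    Realizes x y δ ∧ X K ∧ X W := by
  obtain ⟨K, W, x, y, ⟨δ, h⟩, hW, hy⟩ := IsTwoClusterTilting.precovering (X := X) M
  refine ⟨K, W, x, y, δ, h, mem_of_rightPerp fun W' hW' θ => ?_, hW⟩
  obtain ⟨c, rfl⟩ := h.exists_pull_eq θ (ex_eq_zero hW' hW _)
  obtain ⟨b, rfl⟩ := hy _ c hW'
  rw [pull_comp, h.pull_snd, pull_zero']

/-- Pulling back an `X`-resolution of `N` along `m : M ⟶ N` gives a kernel of `m` in `C / [X]` which
`E(Y, -)`, for `Y` in `X`, sends to a kernel, and `E(-, Y)` to a cokernel. -/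
lemma exists_kernel {M N : C} (m : M ⟶ N) : ∃ (K : C) (k : K ⟶ M),
    k ≫ m ∈ (factorIdeal X).carrier K N ∧
    (∀ (Y : C) (η : Ex Y M), push m η = 0 → ∃ ξ, push k ξ = η) ∧
    (∀ (Y : C) (ξ : Ex Y K), X Y → push k ξ = 0 → ξ = 0) ∧
    (∀ (Y : C) (θ : Ex M Y), pull θ k = 0 → ∃ ξ, pull ξ m = θ) ∧
    (∀ (Y : C) (θ : Ex K Y), X Y → ∃ ξ, pull ξ k = θ) := by
  obtain ⟨H, W, x, y, δ, h, hH, hW⟩ := exists_resolution X N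
  obtain ⟨K, i, p, hK⟩ := exists_realizes (pull δ m)
  refine ⟨K, p, ?_, fun Y η => hK.exists_push_eq_of_pull η, fun Y ξ hY hξ => ?_, fun Y θ hθ => ?_,
    fun Y θ hY => hK.exists_pull_snd_eq θ (ex_eq_zero hH hY _)⟩
  · obtain ⟨b, hb⟩ := h.exists_lift (p ≫ m) (by rw [pull_comp, hK.pull_snd])
    exact ⟨W, hW, b, y, hb⟩
  · obtain ⟨η, rfl⟩ := hK.exists_push_fst_eq ξ hξ
    rw [ex_eq_zero hY hH η, push_zero']
  · obtain ⟨a, rfl⟩ := hK.exists_push_eq θ hθ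
    exact ⟨push a δ, by rw [push_pull]⟩

/-- Pushing an `X`-coresolution of `M` out along `m : M ⟶ N` gives a cokernel of `m` in `C / [X]`
which `E(Y, -)`, for `Y` in `X`, sends to a cokernel, and `E(-, Y)` to a kernel. -/
lemma exists_cokernel {M N : C} (m : M ⟶ N) : ∃ (Q : C) (q : N ⟶ Q),
    m ≫ q ∈ (factorIdeal X).carrier M Q ∧
    (∀ (Y : C) (θ : Ex N Y), pull θ m = 0 → ∃ ξ, pull ξ q = θ) ∧
    (∀ (Y : C) (ξ : Ex Q Y), X Y → pull ξ q = 0 → ξ = 0) ∧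
    (∀ (Y : C) (η : Ex Y N), push q η = 0 → ∃ ξ, push m ξ = η) ∧
    (∀ (Y : C) (η : Ex Y Q), X Y → ∃ ξ, push q ξ = η) := by
  obtain ⟨W, L, x, y, δ, h, hW, hL⟩ := exists_coresolution X M
  obtain ⟨Q, i, p, hQ⟩ := exists_realizes (push m δ)
  refine ⟨Q, i, ?_, fun Y θ => hQ.exists_pull_eq_of_push θ, fun Y ξ hY hξ => ?_, fun Y η hη => ?_,
    fun Y η hY => hQ.exists_push_fst_eq η (ex_eq_zero hY hL _)⟩
  · obtain ⟨b, hb⟩ := h.exists_desc (m ≫ i) (by rw [push_comp, hQ.push_fst])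
    exact ⟨W, hW, x, b, hb⟩
  · obtain ⟨η, rfl⟩ := hQ.exists_pull_snd_eq ξ hξ
    rw [ex_eq_zero hL hY η, pull_zero']
  · obtain ⟨c, rfl⟩ := hQ.exists_pull_eq η hη
    exact ⟨pull δ c, by rw [push_pull]⟩

end ClusterTilting

/-! ### The functors `F` and `K` are fully faithful and exact -/

section Functors

variable {C : Type u} [Category.{v} C] [Preadditive C] [HasZeroObject C] [HasBinaryBiproducts C]
  [ExtriangulatedCategory C] (X : ObjectProperty C) [IsTwoClusterTilting X]

instance : HasZeroObject (QuotBy X) :=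
  Functor.hasZeroObject_of_additive (factorIdeal X).proj

instance : HasBinaryBiproducts (QuotBy X) :=
  have : HasFiniteProducts C := hasFiniteProducts_of_has_binary_and_terminal
  have := Functor.hasFiniteProducts_of_additive_of_essSurj (factorIdeal X).proj
  HasBinaryBiproducts.of_hasBinaryProducts

variable {X} in
lemma proj_map_eq_zero {M N : C} {f : M ⟶ N} :
    (factorIdeal X).proj.map f = 0 ↔ f ∈ (factorIdeal X).carrier M N := by
  rw [← Functor.map_zero (factorIdeal X).proj, Quotient.functor_map_eq_iff]
  simp [AddIdeal.rel]

/-- A morphism out of `M` that kills an extension with middle term in `X` is zero in `C / [X]`. -/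
lemma proj_map_eq_zero_of_push {M N W L : C} {x : M ⟶ W} {y : W ⟶ L} {δ : Ex L M}
    (h : Realizes x y δ) (hW : X W) {m : M ⟶ N} (hm : push m δ = 0) :
    (factorIdeal X).proj.map m = 0 := by
  obtain ⟨b, hb⟩ := h.exists_desc m hm
  exact proj_map_eq_zero.2 ⟨W, hW, x, b, hb⟩

/-- A morphism into `N` along which an extension with middle term in `X` pulls back to zero is zero in
`C / [X]`. -/
lemma proj_map_eq_zero_of_pull {M N W K : C} {x : K ⟶ W} {y : W ⟶ N} {δ : Ex N K}
    (h : Realizes x y δ) (hW : X W) {m : M ⟶ N} (hm : pull δ m = 0) :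
    (factorIdeal X).proj.map m = 0 := by
  obtain ⟨b, hb⟩ := h.exists_lift m hm
  exact proj_map_eq_zero.2 ⟨W, hW, b, y, hb⟩

variable {X} in
lemma push_eq_push {M N Y : C} (hY : X Y) {f g : M ⟶ N}
    (h : (factorIdeal X).proj.map f = (factorIdeal X).proj.map g) (δ : Ex Y M) :
    push f δ = push g δ := by
  rw [← sub_eq_zero, ← Functor.map_sub] at h
  obtain ⟨W, hW, a, b, hab⟩ := proj_map_eq_zero.1 h
  rw [← sub_eq_zero, ← push_sub, ← hab, push_factor_eq_zero hY hW]

variable {X} in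
lemma pull_eq_pull {M N Y : C} (hY : X Y) {f g : M ⟶ N}
    (h : (factorIdeal X).proj.map f = (factorIdeal X).proj.map g) (δ : Ex N Y) :
    pull δ f = pull δ g := by
  rw [← sub_eq_zero, ← Functor.map_sub] at h
  obtain ⟨W, hW, a, b, hab⟩ := proj_map_eq_zero.1 h
  rw [← sub_eq_zero, ← pull_sub, ← hab, pull_factor_eq_zero hW hY]

/-- The object of the stable category given by an object of `X`. -/
abbrev stab {Y : C} (hY : X Y) : Stable X := ((projIdeal C).restrict X).proj.obj ⟨Y, hY⟩

/-- The morphism of the stable category given by a morphism of `X`. -/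
abbrev stabMap {Y Y' : C} (hY : X Y) (hY' : X Y') (c : Y ⟶ Y') : stab X hY ⟶ stab X hY' :=
  ((projIdeal C).restrict X).proj.map (ObjectProperty.homMk c)

/-- The object of the costable category given by an object of `X`. -/
abbrev costab {Y : C} (hY : X Y) : Costable X := ((injIdeal C).restrict X).proj.obj ⟨Y, hY⟩

/-- The morphism of the costable category given by a morphism of `X`. -/
abbrev costabMap {Y Y' : C} (hY : X Y) (hY' : X Y') (c : Y ⟶ Y') : costab X hY ⟶ costab X hY' :=
  ((injIdeal C).restrict X).proj.map (ObjectProperty.homMk c)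

instance : (functorF X).Faithful where
  map_injective {M N f g} h := by
    obtain ⟨f, rfl⟩ := (factorIdeal X).proj.map_surjective f
    obtain ⟨g, rfl⟩ := (factorIdeal X).proj.map_surjective g
    obtain ⟨W, L, x, y, δ, hδ, hW, hL⟩ := exists_coresolution X M.as
    rw [← sub_eq_zero, ← Functor.map_sub]
    refine proj_map_eq_zero_of_push X hδ hW ?_
    rw [push_sub, sub_eq_zero]
    exact ConcreteCategory.congr_hom
      (congrArg (fun t => NatTrans.app (InducedCategory.Hom.hom t) (op (stab X hL))) h) δ

instance : (functorK X).Faithful where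
  map_injective {M N f g} h := by
    obtain ⟨f, rfl⟩ : ∃ t, f = Quiver.Hom.op t := ⟨f.unop, rfl⟩
    obtain ⟨g, rfl⟩ : ∃ t, g = Quiver.Hom.op t := ⟨g.unop, rfl⟩
    obtain ⟨f, rfl⟩ := (factorIdeal X).proj.map_surjective f
    obtain ⟨g, rfl⟩ := (factorIdeal X).proj.map_surjective g
    obtain ⟨K, W, x, y, δ, hδ, hK, hW⟩ := exists_resolution X M.unop.as
    refine congrArg Quiver.Hom.op ?_
    rw [← sub_eq_zero, ← Functor.map_sub]
    refine proj_map_eq_zero_of_pull X hδ hW ?_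
    rw [pull_sub, sub_eq_zero]
    exact ConcreteCategory.congr_hom
      (congrArg (fun t => NatTrans.app (InducedCategory.Hom.hom t) (costab X hK)) h) δ

/-- A natural transformation is determined by the image of the generator `δ` of `E(-, M)`; this image
vanishes on the middle term of the coresolution, hence has the form `m · δ`. -/
instance : (functorF X).Full where
  map_surjective {M N} φ := by
    obtain ⟨W, L, x, y, δ, hδ, hW, hL⟩ := exists_coresolution X M.as
    have nat : ∀ {Y Y' : C} (hY : X Y) (hY' : X Y') (c : Y ⟶ Y') (η : Ex Y' M.as),
        φ.hom.app (op (stab X hY)) (pull η c) = pull (φ.hom.app (op (stab X hY')) η) c :=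
      fun hY hY' c η => ConcreteCategory.congr_hom (φ.hom.naturality (stabMap X hY hY' c).op) η
    obtain ⟨m, hm⟩ := hδ.exists_push_eq (φ.hom.app (op (stab X hL)) δ)
      (by rw [← nat hW hL, hδ.pull_snd]; exact map_zero (φ.hom.app (op (stab X hW))).hom)
    refine ⟨(factorIdeal X).proj.map m, ?_⟩
    apply ObjectProperty.hom_ext
    ext Y η
    obtain ⟨c, rfl⟩ := hδ.exists_pull_eq η (ex_eq_zero Y.unop.as.property hW _)
    refine Eq.trans ?_ (nat Y.unop.as.property hL c δ).symm
    rw [← hm, ← push_pull]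
    rfl

instance : (functorK X).Full where
  map_surjective {M N} φ := by
    obtain ⟨K, W, x, y, δ, hδ, hK, hW⟩ := exists_resolution X M.unop.as
    have nat : ∀ {Y Y' : C} (hY : X Y) (hY' : X Y') (c : Y ⟶ Y') (η : Ex M.unop.as Y),
        φ.hom.app (costab X hY') (push c η) = push c (φ.hom.app (costab X hY) η) :=
      fun hY hY' c η => ConcreteCategory.congr_hom (φ.hom.naturality (costabMap X hY hY' c)) η
    obtain ⟨m, hm⟩ := hδ.exists_pull_eq (φ.hom.app (costab X hK) δ)
      (by rw [← nat hK hW, hδ.push_fst]; exact map_zero (φ.hom.app (costab X hW)).hom)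
    refine ⟨((factorIdeal X).proj.map m).op, ?_⟩
    apply ObjectProperty.hom_ext
    ext Y η
    obtain ⟨c, rfl⟩ := hδ.exists_push_eq η (ex_eq_zero hW Y.as.property _)
    refine Eq.trans ?_ (nat hK Y.as.property c δ).symm
    rw [← hm, push_pull]
    rfl

/-- The functor `F`, with values in the category of all functors to abelian groups. -/
abbrev extF : QuotBy X ⥤ (Stable X)ᵒᵖ ⥤ AddCommGrpCat.{v} :=
  functorF X ⋙ AdditiveFunctor.forget _ _

/-- The functor `K`, with values in the category of all functors to abelian groups. -/
abbrev extK : (QuotBy X)ᵒᵖ ⥤ Costable X ⥤ AddCommGrpCat.{v} :=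
  functorK X ⋙ AdditiveFunctor.forget _ _

instance : (extF X).essImage.IsClosedUnderKernels := by
  refine essImage_closedUnderKernels _ fun M N m => ?_
  obtain ⟨m, rfl⟩ := (factorIdeal X).proj.map_surjective m
  obtain ⟨K, k, hk, h₁, h₂, -, -⟩ := exists_kernel X m
  refine ⟨(factorIdeal X).proj.obj K, (factorIdeal X).proj.map k, ?_,
    (exact_iff_app _ _ _).2 fun Y η => h₁ _ η, (mono_iff_app _).2 fun Y ξ => h₂ _ ξ Y.unop.as.property⟩
  rw [← Functor.map_comp, ← Functor.map_comp, proj_map_eq_zero.2 hk, Functor.map_zero]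

instance : (extF X).essImage.IsClosedUnderCokernels := by
  refine essImage_closedUnderCokernels _ fun M N m => ?_
  obtain ⟨m, rfl⟩ := (factorIdeal X).proj.map_surjective m
  obtain ⟨Q, q, hq, -, -, h₁, h₂⟩ := exists_cokernel X m
  refine ⟨(factorIdeal X).proj.obj Q, (factorIdeal X).proj.map q, ?_,
    (exact_iff_app _ _ _).2 fun Y η => h₁ _ η, (epi_iff_app _).2 fun Y ξ => h₂ _ ξ Y.unop.as.property⟩
  rw [← Functor.map_comp, ← Functor.map_comp, proj_map_eq_zero.2 hq, Functor.map_zero]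

instance : (extK X).essImage.IsClosedUnderKernels := by
  refine essImage_closedUnderKernels _ fun M N m => ?_
  obtain ⟨m, rfl⟩ : ∃ t, m = Quiver.Hom.op t := ⟨m.unop, rfl⟩
  obtain ⟨m, rfl⟩ := (factorIdeal X).proj.map_surjective m
  obtain ⟨Q, q, hq, h₁, h₂, -, -⟩ := exists_cokernel X m
  refine ⟨op ((factorIdeal X).proj.obj Q), ((factorIdeal X).proj.map q).op, ?_,
    (exact_iff_app _ _ _).2 fun Y η => h₁ _ η, (mono_iff_app _).2 fun Y ξ => h₂ _ ξ Y.as.property⟩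
  rw [← Functor.map_comp, ← op_comp, ← Functor.map_comp, proj_map_eq_zero.2 hq, op_zero,
    Functor.map_zero]

instance : (extK X).essImage.IsClosedUnderCokernels := by
  refine essImage_closedUnderCokernels _ fun M N m => ?_
  obtain ⟨m, rfl⟩ : ∃ t, m = Quiver.Hom.op t := ⟨m.unop, rfl⟩
  obtain ⟨m, rfl⟩ := (factorIdeal X).proj.map_surjective m
  obtain ⟨K, k, hk, -, -, h₁, h₂⟩ := exists_kernel X m
  refine ⟨op ((factorIdeal X).proj.obj K), ((factorIdeal X).proj.map k).op, ?_,
    (exact_iff_app _ _ _).2 fun Y η => h₁ _ η, (epi_iff_app _).2 fun Y ξ => h₂ _ ξ Y.as.property⟩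
  rw [← Functor.map_comp, ← op_comp, ← Functor.map_comp, proj_map_eq_zero.2 hk, op_zero,
    Functor.map_zero]

instance : Abelian (QuotBy X) := abelianOfEssImage (extF X)

lemma epsF_iff (S : ShortComplex (QuotBy X)) : epsF X S ↔ S.ShortExact :=
  shortExact_map_iff_of_essImage (extF X) S

lemma epsK_iff (S : ShortComplex (QuotBy X)) : epsK X S ↔ S.ShortExact :=
  (shortExact_map_iff_of_essImage (extK X) S.op).trans S.shortExact_iff_op.symm

variable {X}

lemma push_surjective_of_epi {M N : C} (f : M ⟶ N) [Epi ((factorIdeal X).proj.map f)] {Y : C}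
    (hY : X Y) (η : Ex Y N) : ∃ ξ, push f ξ = η := by
  have := preservesFiniteColimits_of_essImage (extF X)
  exact (epi_iff_app ((extF X).map ((factorIdeal X).proj.map f))).1 inferInstance
    (op (stab X hY)) η

lemma pull_surjective_of_mono {M N : C} (f : M ⟶ N) [Mono ((factorIdeal X).proj.map f)] {Y : C}
    (hY : X Y) (η : Ex M Y) : ∃ ξ, pull ξ f = η := by
  have := preservesFiniteColimits_of_essImage (extK X)
  exact (epi_iff_app ((extK X).map ((factorIdeal X).proj.map f).op)).1 inferInstance
    (costab X hY) η

end Functors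

/-! ### The equivalences with finitely presented modules -/

section Equivalences

variable {C : Type u} [Category.{v} C] [Preadditive C] [HasZeroObject C] [HasBinaryBiproducts C]
  [ExtriangulatedCategory C] (X : ObjectProperty C) [IsTwoClusterTilting X]

lemma rightFp_functorF (M : QuotBy X) : rightFp (Stable X) ((functorF X).obj M) := by
  obtain ⟨W, L, x, y, δ, h, hW, hL⟩ := exists_coresolution X M.as
  refine rightFp_of_generator _ (stabMap X hW hL y) δ
    (fun Y η => ?_) h.pull_snd (fun Y c hc => ?_)
  · obtain ⟨c, hc⟩ := h.exists_pull_eq η (ex_eq_zero Y.as.property hW _)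
    exact ⟨stabMap X Y.as.property hL c, hc⟩
  · obtain ⟨c, rfl⟩ := ((projIdeal C).restrict X).proj.map_surjective c
    obtain ⟨b, hb⟩ := h.exists_lift c.hom hc
    refine ⟨stabMap X Y.as.property hW b, ?_⟩
    rw [← Functor.map_comp]
    exact congrArg _ (ObjectProperty.hom_ext _ hb)

lemma leftFp_functorK (M : (QuotBy X)ᵒᵖ) : leftFp (Costable X) ((functorK X).obj M) := by
  obtain ⟨K, W, x, y, δ, h, hK, hW⟩ := exists_resolution X M.unop.as
  refine leftFp_of_generator _ (costabMap X hK hW x) δ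
    (fun Y η => ?_) h.push_fst (fun Y c hc => ?_)
  · obtain ⟨c, hc⟩ := h.exists_push_eq η (ex_eq_zero hW Y.as.property _)
    exact ⟨costabMap X hK Y.as.property c, hc⟩
  · obtain ⟨c, rfl⟩ := ((injIdeal C).restrict X).proj.map_surjective c
    obtain ⟨b, hb⟩ := h.exists_desc c.hom hc
    refine ⟨costabMap X hW Y.as.property b, ?_⟩
    rw [← Functor.map_comp]
    exact congrArg _ (ObjectProperty.hom_ext _ hb)

variable {X}

/-- The functor `F` sends a syzygy of `L` to the functor represented by `L`. -/
lemma isIso_yonedaHom {A P L : C} {x : A ⟶ P} {y : P ⟶ L} {ω : Ex L A} (h : Realizes x y ω)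
    (hP : eProjective C P) (hL : X L) :
    IsIso (yonedaHom (L := stab X hL) (extLeft X A) ω) := by
  refine isIso_of_app_bijective _ (fun Y (c : Y.unop ⟶ stab X hL) hc => ?_) (fun Y η => ?_)
  · obtain ⟨c, rfl⟩ := ((projIdeal C).restrict X).proj.map_surjective c
    obtain ⟨b, hb⟩ := h.exists_lift c.hom hc
    refine (Quotient.functor_map_eq_iff _ c 0).2 ?_
    change c - 0 ∈ ((projIdeal C).restrict X).carrier _ _
    rw [sub_zero]
    change ExtensionData.E.map c.hom.op = 0
    ext B θ
    change pull θ c.hom = 0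
    rw [← hb, pull_comp, hP.ex_eq_zero (pull θ y), pull_zero']
  · obtain ⟨c, hc⟩ := h.exists_pull_eq η (ex_eq_zero Y.unop.as.property hP.mem _)
    exact ⟨stabMap X Y.unop.as.property hL c, hc⟩

/-- The functor `K` sends a cosyzygy of `L` to the functor represented by `L`. -/
lemma isIso_coyonedaHom {B I L : C} {x : L ⟶ I} {y : I ⟶ B} {ω : Ex B L} (h : Realizes x y ω)
    (hI : eInjective C I) (hL : X L) :
    IsIso (coyonedaHom (L := costab X hL) (extRight X B) ω) := by
  refine isIso_of_app_bijective _ (fun Y (c : costab X hL ⟶ Y) hc => ?_) (fun Y η => ?_)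
  · obtain ⟨c, rfl⟩ := ((injIdeal C).restrict X).proj.map_surjective c
    obtain ⟨b, hb⟩ := h.exists_desc c.hom hc
    refine (Quotient.functor_map_eq_iff _ c 0).2 ?_
    change c - 0 ∈ ((injIdeal C).restrict X).carrier _ _
    rw [sub_zero]
    intro Z
    ext θ
    change push c.hom θ = 0
    rw [← hb, push_comp, hI.ex_eq_zero (push x θ), push_zero']
  · obtain ⟨c, hc⟩ := h.exists_push_eq η (ex_eq_zero hI.mem Y.as.property _)
    exact ⟨costabMap X hL Y.as.property c, hc⟩

lemma mem_essImage_extF (hP : EnoughEProjectives C) {N : RightMod (Stable X)}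
    (hN : rightFp (Stable X) N) : (extF X).essImage N.obj := by
  have key (L : Stable X) : (extF X).essImage (preadditiveYoneda.obj L) := by
    obtain ⟨A, P, x, y, ⟨ω, h⟩, hP⟩ := hP L.as.obj
    have := isIso_yonedaHom h hP L.as.property
    exact ⟨(factorIdeal X).proj.obj A, ⟨(asIso (yonedaHom (L := L) (extLeft X A) ω)).symm⟩⟩
  obtain ⟨m, n, P, Q, f, ⟨e⟩⟩ := hN
  exact (extF X).essImage.prop_of_iso e.symm ((extF X).essImage.prop_cokernel f
    (sigma_mem_essImage _ _ fun i => key _) (sigma_mem_essImage _ _ fun i => key _))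

lemma mem_essImage_extK (hI : EnoughEInjectives C) {N : LeftMod (Costable X)}
    (hN : leftFp (Costable X) N) : (extK X).essImage N.obj := by
  have key (L : Costable X) : (extK X).essImage (preadditiveCoyoneda.obj (op L)) := by
    obtain ⟨I, B, x, y, ⟨ω, h⟩, hI⟩ := hI L.as.obj
    have := isIso_coyonedaHom h hI L.as.property
    exact ⟨op ((factorIdeal X).proj.obj B), ⟨(asIso (coyonedaHom (L := L) (extRight X B) ω)).symm⟩⟩
  obtain ⟨m, n, P, Q, f, ⟨e⟩⟩ := hN
  exact (extK X).essImage.prop_of_iso e.symm ((extK X).essImage.prop_cokernel f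
    (sigma_mem_essImage _ _ fun i => key _) (sigma_mem_essImage _ _ fun i => key _))

lemma isEquivalence_lift_of_essImage {D : Type*} [Category* D] {A : Type*} [Category* A]
    {P : ObjectProperty A} {Q : ObjectProperty P.FullSubcategory} (F : D ⥤ P.FullSubcategory)
    [F.Full] [F.Faithful] (hF : ∀ M, Q (F.obj M)) (h : ∀ N, Q N → (F ⋙ P.ι).essImage N.obj) :
    (Q.lift F hF).IsEquivalence where
  essSurj := ⟨fun N => by
    obtain ⟨M, ⟨e⟩⟩ := h N.obj N.property
    exact ⟨M, ⟨Q.isoMk (P.isoMk e)⟩⟩⟩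

variable (X)

lemma isEquivalence_functorF (hP : EnoughEProjectives C) :
    ((rightFp (Stable X)).lift (functorF X) (rightFp_functorF X)).IsEquivalence :=
  isEquivalence_lift_of_essImage _ _ fun _ => mem_essImage_extF hP

lemma isEquivalence_functorK (hI : EnoughEInjectives C) :
    ((leftFp (Costable X)).lift (functorK X) (leftFp_functorK X)).IsEquivalence :=
  isEquivalence_lift_of_essImage _ _ fun _ => mem_essImage_extK hI

lemma isAbelian_rightFp (hP : EnoughEProjectives C) :
    IsAbelian (rightFp (Stable X)).FullSubcategory := by
  let G := (rightFp (Stable X)).lift (functorF X) (rightFp_functorF X)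
  have : G.IsEquivalence := isEquivalence_functorF X hP
  have := Functor.hasFiniteProducts_of_additive_of_essSurj G
  exact ⟨abelianOfEquivalence G.inv, rfl⟩

lemma isExactCategory_epsK : IsExactCategory (epsK X) := by
  have : epsK X = fun S => S.ShortExact := by
    ext S
    exact epsK_iff X S
  rw [this]
  exact isExactCategory_shortExact

lemma isExactCategory_epsFp (hI : EnoughEInjectives C) : IsExactCategory (epsFp (Costable X)) := by
  let G := (leftFp (Costable X)).lift (functorK X) (leftFp_functorK X)
  have : G.IsEquivalence := isEquivalence_functorK X hI
  have := Functor.hasZeroObject_of_additive G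
  have := Functor.hasFiniteProducts_of_additive_of_essSurj G
  have : HasBinaryBiproducts (leftFp (Costable X)).FullSubcategory :=
    HasBinaryBiproducts.of_hasBinaryProducts
  let I := (leftFp (Costable X)).ι ⋙ AdditiveFunctor.forget (Costable X) AddCommGrpCat.{v}
  have hI : I.essImage = (extK X).essImage := (Functor.essImage_comp_of_essSurj (F := G) (G := I)).symm
  have : I.essImage.IsClosedUnderKernels := by rw [hI]; infer_instance
  have : I.essImage.IsClosedUnderCokernels := by rw [hI]; infer_instance
  let := abelianOfEssImage I
  have : epsFp (Costable X) = fun S => S.ShortExact := by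
    ext S
    exact shortExact_map_iff_of_essImage I S
  rw [this]
  exact isExactCategory_shortExact

end Equivalences

/-! ### Direct summands of sums of objects with local endomorphism rings -/

section Summands

variable {D : Type u} [Category.{v} D] [Preadditive D]

/-- Of any two endomorphisms of `Y` with sum the identity, one is an isomorphism: `Y` is zero, or its
endomorphism ring is local. -/
def ZeroOrLocal (Y : D) : Prop := ∀ f : Y ⟶ Y, IsIso f ∨ IsIso (𝟙 Y - f)

lemma ZeroOrLocal.isLocalRing_end {Y : D} (h : ZeroOrLocal Y) (hY : ¬ IsZero Y) :
    IsLocalRing (End Y) where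
  exists_pair_ne := ⟨1, 0, fun h => hY ((IsZero.iff_id_eq_zero Y).2 h)⟩
  isUnit_or_isUnit_of_add_one {a b} hab := by
    rw [isUnit_iff_isIso, isUnit_iff_isIso, ← sub_eq_of_eq_add' hab.symm]
    exact h a

lemma isIso_or_isIso_of_isLocalRing_end {Y : D} [IsLocalRing (End Y)] (f : Y ⟶ Y) :
    IsIso f ∨ IsIso (𝟙 Y - f) := by
  have := IsLocalRing.isUnit_or_isUnit_of_add_one (R := End Y) (add_sub_cancel f (𝟙 Y))
  rwa [isUnit_iff_isIso, isUnit_iff_isIso] at this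

/-- The summands that are zero can be dropped from a decomposition. -/
lemma exists_bicone_isLocalRing {n : ℕ} {Y : Fin n → D} (b : Bicone Y) (hb : b.IsBilimit)
    (h : ∀ i, ZeroOrLocal (Y i)) : ∃ (m : ℕ) (Y' : Fin m → D) (b' : Bicone Y'),
      Nonempty b'.IsBilimit ∧ b'.pt = b.pt ∧ ∀ i, IsLocalRing (End (Y' i)) := by
  classical
  let e := (Fintype.equivFin {i // ¬ IsZero (Y i)}).symm
  let b' : Bicone (fun j => Y (e j).1) :=
    { pt := b.pt
      π := fun j => b.π (e j).1
      ι := fun j => b.ι (e j).1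
      ι_π := fun j j' => by
        rw [b.ι_π]
        by_cases hj : j = j'
        · subst hj
          simp
        · have : (e j).1 ≠ (e j').1 := fun h' => hj (e.injective (Subtype.ext h'))
          simp [hj, this] }
  refine ⟨_, _, b', ⟨isBilimitOfTotal b' ?_⟩, rfl, fun j => (h _).isLocalRing_end (e j).2⟩
  have h₁ : ∑ j, b'.π j ≫ b'.ι j = ∑ i : {i // ¬ IsZero (Y i)}, b.π i.1 ≫ b.ι i.1 :=
    e.sum_comp fun i => b.π i.1 ≫ b.ι i.1
  rw [h₁, ← Finset.sum_subtype (Finset.univ.filter fun i => ¬ IsZero (Y i)) (by simp)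
    (fun i => b.π i ≫ b.ι i), Finset.sum_filter_of_ne, IsBilimit.total hb]
  intro i _ hi hz
  exact hi (by rw [hz.eq_of_tgt (b.π i) 0, zero_comp])

lemma smd_of_isSplitMono [HasCokernels D] {P : ObjectProperty D} {N A : D} (s : N ⟶ A)
    [IsSplitMono s] (hA : P A) : smd P N :=
  ⟨_, _, ⟨isBilimitBinaryBiconeOfIsSplitMonoOfCokernel (cokernelIsCokernel s)⟩, hA⟩

variable [HasBinaryBiproducts D]

/-- Cancellation of an object `Y` from `Y ⊞ Z ≅ N ⊞ N'` when its component in `N` is split. -/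
lemma exists_iso_of_isSplitMono [HasCokernels D] {Y Z N N' : D} (E : Y ⊞ Z ≅ N ⊞ N')
    (h : IsSplitMono (biprod.inl ≫ E.hom ≫ biprod.fst)) :
    ∃ V, Nonempty (N ≅ Y ⊞ V) ∧ Nonempty (Z ≅ V ⊞ N') := by
  let b := binaryBiconeOfIsSplitMonoOfCokernel (f := biprod.inl ≫ E.hom ≫ biprod.fst)
    (cokernelIsCokernel _)
  let e : N ≅ Y ⊞ cokernel (biprod.inl ≫ E.hom ≫ biprod.fst) :=
    biprod.uniqueUpToIso _ _ (b := b) (isBilimitBinaryBiconeOfIsSplitMonoOfCokernel _)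
  have he : (biprod.inl ≫ E.hom ≫ biprod.fst) ≫ e.hom ≫ biprod.fst = 𝟙 Y := by
    have h₁ : e.hom ≫ biprod.fst = retraction (biprod.inl ≫ E.hom ≫ biprod.fst) := 
      biprod.lift_fst _ _
    rw [h₁, IsSplitMono.id]
  let φ := E ≪≫ biprod.mapIso e (Iso.refl N') ≪≫ biprod.associator _ _ _
  have hφ : biprod.inl ≫ φ.hom ≫ biprod.fst = 𝟙 Y := by
    rw [← he]
    simp [φ]
  have : IsIso (biprod.inl ≫ φ.hom ≫ biprod.fst) := by
    rw [hφ]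
    infer_instance
  exact ⟨_, ⟨e⟩, ⟨Biprod.isoElim φ⟩⟩

/-- Splitting the first summand off a biproduct of a family indexed by `Fin (n + 1)`. -/
def biproductSuccIso [HasFiniteBiproducts D] {n : ℕ} (Y : Fin (n + 1) → D) :
    Y 0 ⊞ (⨁ fun i : Fin n => Y i.succ) ≅ ⨁ Y where
  hom := biprod.desc (biproduct.ι Y 0) (biproduct.desc fun i => biproduct.ι Y i.succ)
  inv := biprod.lift (biproduct.π Y 0) (biproduct.lift fun i => biproduct.π Y i.succ)
  hom_inv_id := by
    ext <;> simp [biproduct.ι_π]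
    exact fun h => absurd h (Fin.succ_ne_zero _).symm
  inv_hom_id := by
    rw [biprod.lift_desc, biproduct.lift_desc, ← Fin.sum_univ_succ
      (fun i => biproduct.π Y i ≫ biproduct.ι Y i), biproduct.total]

/-- A direct summand of a finite sum of objects with zero or local endomorphism rings lies in every
class that contains these objects and is closed under finite sums (Azumaya). The identity of the
first object is the sum of its components through `N` and `N'`; one of these is an isomorphism, so
the object splits off `N` or `N'` and can be cancelled. -/
lemma mem_of_biprod_iso_biproduct [HasFiniteBiproducts D] [HasCokernels D] (S : ObjectProperty D)
    [S.IsClosedUnderIsomorphisms] (hz : ∀ Z, IsZero Z → S Z)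
    (hS : ∀ A B, S A → S B → S (A ⊞ B)) :
    ∀ {n : ℕ} (Y : Fin n → D), (∀ i, ZeroOrLocal (Y i)) → (∀ i, S (Y i)) →
      ∀ N N' : D, (N ⊞ N' ≅ ⨁ Y) → S N
  | 0, Y, _, _, N, N', e => by
    refine hz N ((IsZero.iff_id_eq_zero N).2 ?_)
    have : IsZero (⨁ Y) := (IsZero.iff_id_eq_zero _).2 (by ext i; exact i.elim0)
    rw [← biprod.inl_fst (X := N) (Y := N'), (this.of_iso e).eq_of_tgt biprod.inl 0, zero_comp]
  | n + 1, Y, hY, hY', N, N', e => by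
    have ih := mem_of_biprod_iso_biproduct S hz hS (fun i : Fin n => Y i.succ) (fun i => hY i.succ)
      (fun i => hY' i.succ)
    let E := biproductSuccIso Y ≪≫ e.symm
    have hE : 𝟙 (Y 0) - (biprod.inl ≫ E.hom ≫ biprod.fst) ≫ biprod.inl ≫ E.inv ≫ biprod.fst =
        (biprod.inl ≫ E.hom ≫ biprod.snd) ≫ biprod.inr ≫ E.inv ≫ biprod.fst := by
      have h : biprod.inl ≫ E.hom ≫ (biprod.fst ≫ biprod.inl + biprod.snd ≫ biprod.inr) ≫
          E.inv ≫ biprod.fst = 𝟙 (Y 0) := by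
        rw [biprod.total]
        simp
      rw [sub_eq_iff_eq_add', ← h]
      simp only [Preadditive.add_comp, Preadditive.comp_add, Category.assoc]
    rcases hY 0 ((biprod.inl ≫ E.hom ≫ biprod.fst) ≫ biprod.inl ≫ E.inv ≫ biprod.fst) with h | h
    · obtain ⟨V, ⟨e₁⟩, ⟨e₂⟩⟩ := exists_iso_of_isSplitMono E
        ⟨⟨(biprod.inl ≫ E.inv ≫ biprod.fst) ≫ inv ((biprod.inl ≫ E.hom ≫ biprod.fst) ≫
          biprod.inl ≫ E.inv ≫ biprod.fst), by rw [← Category.assoc, IsIso.hom_inv_id]⟩⟩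
      exact S.prop_of_iso e₁.symm (hS _ _ (hY' 0) (ih V N' e₂.symm))
    · rw [hE] at h
      obtain ⟨V, ⟨e₁⟩, ⟨e₂⟩⟩ := exists_iso_of_isSplitMono (E ≪≫ biprod.braiding N N')
        ⟨⟨(biprod.inr ≫ E.inv ≫ biprod.fst) ≫ inv ((biprod.inl ≫ E.hom ≫ biprod.snd) ≫
          biprod.inr ≫ E.inv ≫ biprod.fst), by
            have : biprod.inl ≫ (E ≪≫ biprod.braiding N N').hom ≫ biprod.fst =
              biprod.inl ≫ E.hom ≫ biprod.snd := by simp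
            rw [this, ← Category.assoc, IsIso.hom_inv_id]⟩⟩
      exact ih N V (biprod.braiding N V ≪≫ e₂.symm)

lemma mem_of_isSplitMono_biproduct [HasFiniteBiproducts D] [HasCokernels D] (S : ObjectProperty D)
    [S.IsClosedUnderIsomorphisms] (hz : ∀ Z, IsZero Z → S Z)
    (hS : ∀ A B, S A → S B → S (A ⊞ B)) {n : ℕ} (Y : Fin n → D) (hY : ∀ i, ZeroOrLocal (Y i))
    (hY' : ∀ i, S (Y i)) {N : D} (s : N ⟶ ⨁ Y) [IsSplitMono s] : S N :=
  mem_of_biprod_iso_biproduct S hz hS Y hY hY' N _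
    (biprod.uniqueUpToIso _ _ (b := binaryBiconeOfIsSplitMonoOfCokernel (cokernelIsCokernel s))
      (isBilimitBinaryBiconeOfIsSplitMonoOfCokernel _)).symm

end Summands

/-! ### Projective and injective objects of `C / [X]` -/

section ProjectivesInjectives

variable {C : Type u} [Category.{v} C] [Preadditive C] [HasZeroObject C] [HasBinaryBiproducts C]
  [ExtriangulatedCategory C] (X : ObjectProperty C) [IsTwoClusterTilting X]

variable {X} in
/-- A lifting problem for a syzygy `A` of `Y` is solved in `E(Y, -)`, where an epimorphism of
`C / [X]` induces a surjection. -/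
lemma projective_of_syzygy {A : QuotBy X} (hA : quotClass X (syzygy X) A) : Projective A where
  factors {M N} f g _ := by
    obtain ⟨P, Y, x, y, hP, hY, ω, h⟩ := hA
    obtain ⟨f, rfl⟩ := (factorIdeal X).proj.map_surjective f
    obtain ⟨g, rfl⟩ := (factorIdeal X).proj.map_surjective g
    obtain ⟨θ, hθ⟩ := push_surjective_of_epi g hY (push f ω)
    obtain ⟨a, rfl⟩ := h.exists_push_eq θ (hP.ex_eq_zero _)
    refine ⟨(factorIdeal X).proj.map a, ?_⟩
    rw [← sub_eq_zero, ← Functor.map_comp, ← Functor.map_sub]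
    exact proj_map_eq_zero_of_push X h hP.mem (by rw [push_sub, push_comp, hθ, sub_self])

variable {X} in
/-- An extension problem for a cosyzygy `B` of `Y` is solved in `E(-, Y)`, where a monomorphism of
`C / [X]` induces a surjection. -/
lemma injective_of_cosyzygy {B : QuotBy X} (hB : quotClass X (cosyzygy X) B) : Injective B where
  factors {M N} f g _ := by
    obtain ⟨Y, I, x, y, hY, hI, ω, h⟩ := hB
    obtain ⟨f, rfl⟩ := (factorIdeal X).proj.map_surjective f
    obtain ⟨g, rfl⟩ := (factorIdeal X).proj.map_surjective g
    obtain ⟨θ, hθ⟩ := pull_surjective_of_mono g hY (pull ω f)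
    obtain ⟨a, rfl⟩ := h.exists_pull_eq θ (hI.ex_eq_zero _)
    refine ⟨(factorIdeal X).proj.map a, ?_⟩
    rw [← sub_eq_zero, ← Functor.map_comp, ← Functor.map_sub]
    exact proj_map_eq_zero_of_pull X h hI.mem (by rw [pull_sub, pull_comp, hθ, sub_self])

/-- Every object of `C / [X]` is a quotient of a syzygy of the last term of a coresolution. -/
lemma exists_epi_of_syzygy (hP : EnoughEProjectives C) (M : QuotBy X) :
    ∃ (A : QuotBy X) (f : A ⟶ M), quotClass X (syzygy X) A ∧ Epi f := by
  obtain ⟨W, L, x, y, δ, h, hW, hL⟩ := exists_coresolution X M.as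
  obtain ⟨A, P, i, p, ⟨ω, hω⟩, hP⟩ := hP L
  obtain ⟨a, ha⟩ := hω.exists_push_eq δ (hP.ex_eq_zero _)
  refine ⟨(factorIdeal X).proj.obj A, (factorIdeal X).proj.map a, ⟨P, L, i, p, hP, hL, ω, hω⟩,
    Preadditive.epi_of_cancel_zero _ fun {N} f hf => ?_⟩
  obtain ⟨f, rfl⟩ := (factorIdeal X).proj.map_surjective f
  refine proj_map_eq_zero_of_push X h hW ?_
  rw [← ha, ← push_comp, push_eq_push (g := 0) hL (by rw [Functor.map_comp, hf, Functor.map_zero])]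
  simp [push]

/-- Every object of `C / [X]` embeds in a cosyzygy of the first term of a resolution. -/
lemma exists_mono_of_cosyzygy (hI : EnoughEInjectives C) (M : QuotBy X) :
    ∃ (B : QuotBy X) (f : M ⟶ B), quotClass X (cosyzygy X) B ∧ Mono f := by
  obtain ⟨K, W, x, y, δ, h, hK, hW⟩ := exists_resolution X M.as
  obtain ⟨I, B, i, p, ⟨ω, hω⟩, hI⟩ := hI K
  obtain ⟨a, ha⟩ := hω.exists_pull_eq δ (hI.ex_eq_zero _)
  refine ⟨(factorIdeal X).proj.obj B, (factorIdeal X).proj.map a, ⟨K, I, i, p, hK, hI, ω, hω⟩,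
    Preadditive.mono_of_cancel_zero _ fun {N} f hf => ?_⟩
  obtain ⟨f, rfl⟩ := (factorIdeal X).proj.map_surjective f
  refine proj_map_eq_zero_of_pull X h hW ?_
  rw [← ha, ← pull_comp, pull_eq_pull (g := 0) hK (by rw [Functor.map_comp, hf, Functor.map_zero])]
  simp [pull]

lemma enoughProjectives_quotBy (hP : EnoughEProjectives C) : EnoughProjectives (QuotBy X) where
  presentation M := by
    obtain ⟨A, f, hA, _⟩ := exists_epi_of_syzygy X hP M
    exact ⟨{ p := A, projective := projective_of_syzygy hA, f := f }⟩

lemma enoughInjectives_quotBy (hI : EnoughEInjectives C) : EnoughInjectives (QuotBy X) where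
  presentation M := by
    obtain ⟨B, f, hB, _⟩ := exists_mono_of_cosyzygy X hI M
    exact ⟨{ J := B, injective := injective_of_cosyzygy hB, f := f }⟩

lemma isProjective_eq_smd (hP : EnoughEProjectives C) :
    isProjective (QuotBy X) = smd (quotClass X (syzygy X)) := by
  ext N
  constructor
  · intro (hN : Projective N)
    obtain ⟨A, f, hA, _⟩ := exists_epi_of_syzygy X hP N
    have : IsSplitMono (Projective.factorThru (𝟙 N) f) := ⟨⟨f, Projective.factorThru_comp _ _⟩⟩
    exact smd_of_isSplitMono (Projective.factorThru (𝟙 N) f) hA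
  · rintro ⟨B, b, -, hb⟩
    have := projective_of_syzygy hb
    exact Retract.projective ⟨b.inl, b.fst, b.inl_fst⟩

lemma isInjective_eq_smd (hI : EnoughEInjectives C) :
    isInjective (QuotBy X) = smd (quotClass X (cosyzygy X)) := by
  ext N
  constructor
  · intro (hN : Injective N)
    obtain ⟨B, f, hB, _⟩ := exists_mono_of_cosyzygy X hI N
    have : IsSplitMono f := ⟨⟨Injective.factorThru (𝟙 N) f, Injective.comp_factorThru _ _⟩⟩
    exact smd_of_isSplitMono f hB
  · rintro ⟨B, b, -, hb⟩
    have := injective_of_cosyzygy hb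
    exact Retract.injective ⟨b.inl, b.fst, b.inl_fst⟩

end ProjectivesInjectives

/-! ### The Krull–Schmidt case -/

section KrullSchmidt

variable {C : Type u} [Category.{v} C] [Preadditive C] [HasZeroObject C] [HasBinaryBiproducts C]
  [ExtriangulatedCategory C] (X : ObjectProperty C) [IsTwoClusterTilting X]

instance : HasFiniteBiproducts (QuotBy X) := Abelian.hasFiniteBiproducts

lemma isKrullSchmidt_quotBy (h : IsKrullSchmidt C) : IsKrullSchmidt (QuotBy X) := by
  intro M
  obtain ⟨n, Y, b, ⟨hb⟩, hM, hY⟩ := h M.as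
  obtain ⟨m, Y', b', hb', hM', hY'⟩ := exists_bicone_isLocalRing ((factorIdeal X).proj.mapBicone b)
    (isBilimitOfPreserves (factorIdeal X).proj hb) (fun i f => by
      have := hY i
      obtain ⟨f, rfl⟩ := (factorIdeal X).proj.map_surjective f
      rcases isIso_or_isIso_of_isLocalRing_end f with hf | hf
      · exact .inl inferInstance
      · refine .inr ?_
        have : IsIso ((factorIdeal X).proj.map (𝟙 (Y i) - f)) := inferInstance
        rwa [Functor.map_sub, CategoryTheory.Functor.map_id] at this)
  exact ⟨m, Y', b', hb', hM'.trans (congrArg (factorIdeal X).proj.obj hM), hY'⟩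

variable {X}

/-- For a syzygy `A` of `Y`, the endomorphisms `a` of `A` with `a · ω = ω · c` are isomorphisms in
`C / [X]` if `c` is an isomorphism. -/
lemma isIso_proj_map_of_push_eq {A P Y : C} {x : A ⟶ P} {y : P ⟶ Y} {ω : Ex Y A}
    (h : Realizes x y ω) (hP : eProjective C P) {a : A ⟶ A} {c : Y ⟶ Y} [IsIso c]
    (hac : push a ω = pull ω c) : IsIso ((factorIdeal X).proj.map a) := by
  obtain ⟨a', ha'⟩ := h.exists_push_eq (pull ω (inv c)) (hP.ex_eq_zero _)
  refine ⟨(factorIdeal X).proj.map a', ?_, ?_⟩ <;>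
  rw [← CategoryTheory.Functor.map_id, ← Functor.map_comp, ← sub_eq_zero, ← Functor.map_sub] <;>
  refine proj_map_eq_zero_of_push X h hP.mem ?_ <;>
  rw [push_sub, push_comp, push_id, sub_eq_zero]
  · rw [hac, push_pull, ha', ← pull_comp, IsIso.hom_inv_id, pull_id]
  · rw [ha', push_pull, hac, ← pull_comp, IsIso.inv_hom_id, pull_id]

/-- For a cosyzygy `B` of `Y`, the endomorphisms `a` of `B` with `ω · a = c · ω` are isomorphisms in
`C / [X]` if `c` is an isomorphism. -/
lemma isIso_proj_map_of_pull_eq {B I Y : C} {x : Y ⟶ I} {y : I ⟶ B} {ω : Ex B Y}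
    (h : Realizes x y ω) (hI : eInjective C I) {a : B ⟶ B} {c : Y ⟶ Y} [IsIso c]
    (hac : pull ω a = push c ω) : IsIso ((factorIdeal X).proj.map a) := by
  obtain ⟨a', ha'⟩ := h.exists_pull_eq (push (inv c) ω) (hI.ex_eq_zero _)
  refine ⟨(factorIdeal X).proj.map a', ?_, ?_⟩ <;>
  rw [← CategoryTheory.Functor.map_id, ← Functor.map_comp, ← sub_eq_zero, ← Functor.map_sub] <;>
  refine proj_map_eq_zero_of_pull X h hI.mem ?_ <;>
  rw [pull_sub, pull_comp, pull_id, sub_eq_zero]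
  · rw [ha', ← push_pull, hac, ← push_comp, IsIso.hom_inv_id, push_id]
  · rw [hac, ← push_pull, ha', ← push_comp, IsIso.inv_hom_id, push_id]

lemma zeroOrLocal_of_syzygy {A P Y : C} {x : A ⟶ P} {y : P ⟶ Y} {ω : Ex Y A}
    (h : Realizes x y ω) (hP : eProjective C P) (hY : X Y) [IsLocalRing (End Y)] :
    ZeroOrLocal ((factorIdeal X).proj.obj A) := by
  intro f
  obtain ⟨f, rfl⟩ := (factorIdeal X).proj.map_surjective f
  obtain ⟨c, hc⟩ := h.exists_pull_eq (push f ω) (ex_eq_zero hY hP.mem _)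
  rcases isIso_or_isIso_of_isLocalRing_end c with _ | _
  · exact .inl (isIso_proj_map_of_push_eq h hP hc.symm)
  · refine .inr ?_
    rw [← CategoryTheory.Functor.map_id, ← Functor.map_sub]
    exact isIso_proj_map_of_push_eq h hP (c := 𝟙 Y - c) (by
      rw [push_sub, pull_sub, hc, push_id, pull_id])

lemma zeroOrLocal_of_cosyzygy {B I Y : C} {x : Y ⟶ I} {y : I ⟶ B} {ω : Ex B Y}
    (h : Realizes x y ω) (hI : eInjective C I) (hY : X Y) [IsLocalRing (End Y)] :
    ZeroOrLocal ((factorIdeal X).proj.obj B) := by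
  intro f
  obtain ⟨f, rfl⟩ := (factorIdeal X).proj.map_surjective f
  obtain ⟨c, hc⟩ := h.exists_push_eq (pull ω f) (ex_eq_zero hI.mem hY _)
  rcases isIso_or_isIso_of_isLocalRing_end c with _ | _
  · exact .inl (isIso_proj_map_of_pull_eq h hI hc.symm)
  · refine .inr ?_
    rw [← CategoryTheory.Functor.map_id, ← Functor.map_sub]
    exact isIso_proj_map_of_pull_eq h hI (c := 𝟙 Y - c) (by
      rw [push_sub, pull_sub, hc, push_id, pull_id])

lemma eq_zero_of_pull_ι_eq_zero {n : ℕ} {Y : Fin n → C} {b : Bicone Y} (hb : b.IsBilimit) {A : C}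
    (θ : Ex b.pt A) (h : ∀ i, pull θ (b.ι i) = 0) : θ = 0 := by
  obtain ⟨B, x, y, hθ⟩ := exists_realizes θ
  choose l hl using fun i => hθ.exists_lift (b.ι i) (h i)
  have : (∑ i, b.π i ≫ l i) ≫ y = 𝟙 b.pt := by
    simp only [Preadditive.sum_comp, Category.assoc, hl, IsBilimit.total hb]
  rw [← pull_id θ, ← this, pull_comp, hθ.pull_snd, pull_zero']

lemma eq_zero_of_push_π_eq_zero {n : ℕ} {Y : Fin n → C} {b : Bicone Y} (hb : b.IsBilimit) {Z : C}
    (θ : Ex Z b.pt) (h : ∀ i, push (b.π i) θ = 0) : θ = 0 := by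
  obtain ⟨B, x, y, hθ⟩ := exists_realizes θ
  choose l hl using fun i => hθ.exists_desc (b.π i) (h i)
  have : x ≫ (∑ i, l i ≫ b.ι i) = 𝟙 b.pt := by
    simp only [Preadditive.comp_sum, reassoc_of% hl, IsBilimit.total hb]
  rw [← push_id θ, ← this, push_comp, hθ.push_fst, push_zero']

variable (X)

/-- If `C` is Krull–Schmidt, every object of `C / [X]` is a quotient of a finite sum of syzygies
with zero or local endomorphism rings. -/
lemma exists_epi_biproduct_of_syzygy (hP : EnoughEProjectives C) (h : IsKrullSchmidt C)
    (M : QuotBy X) : ∃ (n : ℕ) (A : Fin n → QuotBy X) (f : (⨁ A) ⟶ M),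
      (∀ i, ZeroOrLocal (A i)) ∧ (∀ i, quotClass X (syzygy X) (A i)) ∧ Epi f := by
  obtain ⟨W, L, x, y, δ, hδ, hW, hL⟩ := exists_coresolution X M.as
  obtain ⟨n, Y, b, ⟨hb⟩, rfl, hY⟩ := h L
  have hX : ∀ i, X (Y i) := fun i => mem_of_retract hL (b.ι i) (b.π i) (by simp)
  choose A P x' y' hω hP using fun i => hP (Y i)
  choose ω hω using hω
  choose a ha using fun i => (hω i).exists_push_eq (pull δ (b.ι i)) ((hP i).ex_eq_zero _)
  refine ⟨n, fun i => (factorIdeal X).proj.obj (A i),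
    biproduct.desc fun i => (factorIdeal X).proj.map (a i),
    fun i => zeroOrLocal_of_syzygy (hω i) (hP i) (hX i),
    fun i => ⟨P i, Y i, x' i, y' i, hP i, hX i, ω i, hω i⟩,
    Preadditive.epi_of_cancel_zero _ fun {N} f hf => ?_⟩
  obtain ⟨f, rfl⟩ := (factorIdeal X).proj.map_surjective f
  refine proj_map_eq_zero_of_push X hδ hW (eq_zero_of_pull_ι_eq_zero hb _ fun i => ?_)
  have hf' : (factorIdeal X).proj.map (a i ≫ f) = (factorIdeal X).proj.map 0 := by
    have := biproduct.ι _ i ≫= hf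
    rw [biproduct.ι_desc_assoc, comp_zero] at this
    rw [Functor.map_comp, this, Functor.map_zero]
  rw [← push_pull, ← ha, ← push_comp, push_eq_push (hX i) hf']
  simp [push]

/-- If `C` is Krull–Schmidt, every object of `C / [X]` embeds in a finite sum of cosyzygies with
zero or local endomorphism rings. -/
lemma exists_mono_biproduct_of_cosyzygy (hI : EnoughEInjectives C) (h : IsKrullSchmidt C)
    (M : QuotBy X) : ∃ (n : ℕ) (B : Fin n → QuotBy X) (f : M ⟶ ⨁ B),
      (∀ i, ZeroOrLocal (B i)) ∧ (∀ i, quotClass X (cosyzygy X) (B i)) ∧ Mono f := by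
  obtain ⟨K, W, x, y, δ, hδ, hK, hW⟩ := exists_resolution X M.as
  obtain ⟨n, Y, b, ⟨hb⟩, rfl, hY⟩ := h K
  have hX : ∀ i, X (Y i) := fun i => mem_of_retract hK (b.ι i) (b.π i) (by simp)
  choose I B x' y' hω hI using fun i => hI (Y i)
  choose ω hω using hω
  choose a ha using fun i => (hω i).exists_pull_eq (push (b.π i) δ) ((hI i).ex_eq_zero _)
  refine ⟨n, fun i => (factorIdeal X).proj.obj (B i),
    biproduct.lift fun i => (factorIdeal X).proj.map (a i),
    fun i => zeroOrLocal_of_cosyzygy (hω i) (hI i) (hX i),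
    fun i => ⟨Y i, I i, x' i, y' i, hX i, hI i, ω i, hω i⟩,
    Preadditive.mono_of_cancel_zero _ fun {N} f hf => ?_⟩
  obtain ⟨f, rfl⟩ := (factorIdeal X).proj.map_surjective f
  refine proj_map_eq_zero_of_pull X hδ hW (eq_zero_of_push_π_eq_zero hb _ fun i => ?_)
  have hf' : (factorIdeal X).proj.map (f ≫ a i) = (factorIdeal X).proj.map 0 := by
    have := hf =≫ biproduct.π _ i
    rw [Category.assoc, biproduct.lift_π, zero_comp] at this
    rw [Functor.map_comp, this, Functor.map_zero]
  rw [push_pull, ← ha, ← pull_comp, pull_eq_pull (hX i) hf']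
  simp [pull]

lemma isoClosure_quotClass_of_isZero {P : ObjectProperty C} {Z : C} (hZ : P Z) (hZ' : IsZero Z)
    (M : QuotBy X) (hM : IsZero M) : (quotClass X P).isoClosure M :=
  ⟨(factorIdeal X).proj.obj Z, hZ, ⟨hM.iso ((factorIdeal X).proj.map_isZero hZ')⟩⟩

lemma isoClosure_quotClass_biprod {P : ObjectProperty C} (hP : ∀ A B, P A → P B → P (A ⊞ B))
    (M N : QuotBy X) (hM : (quotClass X P).isoClosure M) (hN : (quotClass X P).isoClosure N) :
    (quotClass X P).isoClosure (M ⊞ N) := by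
  obtain ⟨M', hM, ⟨e⟩⟩ := hM
  obtain ⟨N', hN, ⟨e'⟩⟩ := hN
  have := preservesBinaryBiproducts_of_preservesBiproducts (factorIdeal X).proj
  exact ⟨(factorIdeal X).proj.obj (M'.as ⊞ N'.as), hP _ _ hM hN,
    ⟨biprod.mapIso e e' ≪≫ ((factorIdeal X).proj.mapBiprod M'.as N'.as).symm⟩⟩

lemma eProjective_biprod {P Q : C} (hP : eProjective C P) (hQ : eProjective C Q) :
    eProjective C (P ⊞ Q) := by
  intro A B Z x y h f
  obtain ⟨g, hg⟩ := hP x y h (biprod.inl ≫ f)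
  obtain ⟨g', hg'⟩ := hQ x y h (biprod.inr ≫ f)
  exact ⟨biprod.desc g g', by ext <;> simp [hg, hg']⟩

lemma eInjective_biprod {I J : C} (hI : eInjective C I) (hJ : eInjective C J) :
    eInjective C (I ⊞ J) := by
  intro A B Z x y h f
  obtain ⟨g, hg⟩ := hI x y h (f ≫ biprod.fst)
  obtain ⟨g', hg'⟩ := hJ x y h (f ≫ biprod.snd)
  exact ⟨biprod.lift g g', by ext <;> simp [hg, hg']⟩

lemma syzygy_biprod {A B : C} (hA : syzygy X A) (hB : syzygy X B) : syzygy X (A ⊞ B) := by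
  obtain ⟨P, Y, x, y, hP, hY, ω, h⟩ := hA
  obtain ⟨P', Y', x', y', hP', hY', ω', h'⟩ := hB
  exact ⟨_, _, _, _, eProjective_biprod hP hP', ClosedUnderFiniteCoproducts.biprod _ _ hY hY',
    _, ExtriangulatedCategory.realizes_sum h h'⟩

lemma cosyzygy_biprod {A B : C} (hA : cosyzygy X A) (hB : cosyzygy X B) : cosyzygy X (A ⊞ B) := by
  obtain ⟨Y, I, x, y, hY, hI, ω, h⟩ := hA
  obtain ⟨Y', I', x', y', hY', hI', ω', h'⟩ := hB
  exact ⟨_, _, _, _, ClosedUnderFiniteCoproducts.biprod _ _ hY hY', eInjective_biprod hI hI',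
    _, ExtriangulatedCategory.realizes_sum h h'⟩

lemma syzygy_zero : syzygy X 0 :=
  ⟨_, _, _, _, fun _ _ _ _ _ _ _ => ⟨0, ((biprod_isZero_iff _ _).2 ⟨isZero_zero C, isZero_zero C⟩).eq_of_src _ _⟩,
    ClosedUnderFiniteCoproducts.zero _ (isZero_zero C), 0,
    ExtriangulatedCategory.realizes_zero 0 0⟩

lemma cosyzygy_zero : cosyzygy X 0 :=
  ⟨_, _, _, _, ClosedUnderFiniteCoproducts.zero _ (isZero_zero C),
    fun _ _ _ _ _ _ _ => ⟨0, ((biprod_isZero_iff _ _).2 ⟨isZero_zero C, isZero_zero C⟩).eq_of_tgt _ _⟩, 0,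
    ExtriangulatedCategory.realizes_zero 0 0⟩

lemma isProjective_eq_isoClosure (hP : EnoughEProjectives C) (h : IsKrullSchmidt C) :
    isProjective (QuotBy X) = (quotClass X (syzygy X)).isoClosure := by
  ext N
  constructor
  · intro (hN : Projective N)
    obtain ⟨n, A, f, hA, hA', _⟩ := exists_epi_biproduct_of_syzygy X hP h N
    have : IsSplitMono (Projective.factorThru (𝟙 N) f) := ⟨⟨f, Projective.factorThru_comp _ _⟩⟩
    exact mem_of_isSplitMono_biproduct _ (isoClosure_quotClass_of_isZero X (syzygy_zero X)
      (isZero_zero C)) (isoClosure_quotClass_biprod X fun _ _ => syzygy_biprod X) A hA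
      (fun i => ObjectProperty.le_isoClosure _ _ (hA' i)) (Projective.factorThru (𝟙 N) f)
  · rintro ⟨A, hA, ⟨e⟩⟩
    exact Projective.of_iso e.symm (projective_of_syzygy hA)

lemma isInjective_eq_isoClosure (hI : EnoughEInjectives C) (h : IsKrullSchmidt C) :
    isInjective (QuotBy X) = (quotClass X (cosyzygy X)).isoClosure := by
  ext N
  constructor
  · intro (hN : Injective N)
    obtain ⟨n, B, f, hB, hB', _⟩ := exists_mono_biproduct_of_cosyzygy X hI h N
    have : IsSplitMono f := ⟨⟨Injective.factorThru (𝟙 N) f, Injective.comp_factorThru _ _⟩⟩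
    exact mem_of_isSplitMono_biproduct _ (isoClosure_quotClass_of_isZero X (cosyzygy_zero X)
      (isZero_zero C)) (isoClosure_quotClass_biprod X fun _ _ => cosyzygy_biprod X) B hB
      (fun i => ObjectProperty.le_isoClosure _ _ (hB' i)) f
  · rintro ⟨B, hB, ⟨e⟩⟩
    exact Injective.of_iso e.symm (injective_of_cosyzygy hB)

end KrullSchmidt

end Extri

end

theorem mainTheorem7 {C : Type u} [Category.{v} C] [Preadditive C] [HasZeroObject C]
    [HasBinaryBiproducts C] [ExtriangulatedCategory C]
    (hP : EnoughEProjectives C) (hI : EnoughEInjectives C)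
    (X : ObjectProperty C) [IsTwoClusterTilting X] :
    -- (a)
    (IsAbelian (QuotBy X) ∧ EnoughProjectives (QuotBy X) ∧ EnoughInjectives (QuotBy X) ∧
      isProjective (QuotBy X) = smd (quotClass X (syzygy X)) ∧
      isInjective (QuotBy X) = smd (quotClass X (cosyzygy X))) ∧
    -- (b)
    (IsKrullSchmidt C → IsKrullSchmidt (QuotBy X) ∧
      isProjective (QuotBy X) = (quotClass X (syzygy X)).isoClosure ∧
      isInjective (QuotBy X) = (quotClass X (cosyzygy X)).isoClosure) ∧
    -- (c), the functor `F`
    (IsAbelian (rightFp (Stable X)).FullSubcategory ∧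
      ∃ hF : ∀ M, rightFp (Stable X) ((functorF X).obj M),
        ((rightFp (Stable X)).lift (functorF X) hF).IsEquivalence ∧
        ((rightFp (Stable X)).lift (functorF X) hF).Additive ∧
        ∀ S : ShortComplex (QuotBy X), S.ShortExact ↔ epsF X S) ∧
    -- (c), the functor `K`
    (IsExactCategory (epsK X) ∧ IsExactCategory (epsFp (Costable X)) ∧
      ∃ hK : ∀ M, leftFp (Costable X) ((functorK X).obj M),
        ((leftFp (Costable X)).lift (functorK X) hK).IsEquivalence ∧
        ((leftFp (Costable X)).lift (functorK X) hK).Additive ∧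
        ∀ S : ShortComplex (QuotBy X), epsK X S ↔
          epsFp (Costable X) (S.op.map ((leftFp (Costable X)).lift (functorK X) hK))) := by
  refine ⟨⟨⟨inferInstance, rfl⟩, enoughProjectives_quotBy X hP, enoughInjectives_quotBy X hI,
      isProjective_eq_smd X hP, isInjective_eq_smd X hI⟩,
    fun h => ⟨isKrullSchmidt_quotBy X h, isProjective_eq_isoClosure X hP h,
      isInjective_eq_isoClosure X hI h⟩,
    ⟨isAbelian_rightFp X hP, rightFp_functorF X, isEquivalence_functorF X hP, inferInstance,
      fun S => (epsF_iff X S).symm⟩,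
    isExactCategory_epsK X, isExactCategory_epsFp X hI, leftFp_functorK X,
    isEquivalence_functorK X hI, inferInstance, fun S => Iff.rfl⟩
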